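/- For a single bosonic mode with Fock basis $(|n\rangle)_{n\ge0}$, let $\hat a^\dagger$ be the creation operator, $\hat a^\dagger|n\rangle=\sqrt{n+1}\,|n+1\rangle$, let $\hat D(\beta)=\exp(\beta\hat a^\dagger-\bar\beta\hat a)$ be the displacement operators, $\hat S(z)=\exp\big(\tfrac12(\bar z\hat a^2-z\hat a^{\dagger2})\big)$ the squeezing operators, and $|\alpha\rangle=\hat D(\alpha)|0\rangle$ the coherent states ($\beta,z,\alpha\in\mathbb C$). A pure state of finite stellar rank $r$ is described as $$|y\rangle=\frac1{\sqrt{\mathcal N}}\Big[\prod_{j=1}^{r}\hat D(\beta_j)\,\hat a^\dagger\,\hat D(\beta_j)^\dagger\Big]\hat S(z)|\alpha\rangle ,$$ where the order of the photon additions is fixed, the factor $j=1$ acting first, and $\mathcal N>0$ makes $|y\rangle$ a unit vector. For $\xi=(\xi_1,\dots,\xi_r)\in\mathbb R^r$ let $|\tilde y\rangle$ be the (unnormalised) vector obtained from this expression, with the same $\mathcal N$ and the same order, by replacing the $j$-th photon addition $\hat a^\dagger$ by the attenuated photon addition $\hat a^\dagger(\cosh\xi_j)^{-\hat a^\dagger\hat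 a}$. For such states $|y_1\rangle,\dots,|y_m\rangle$, with ranks $r_1,\dots,r_m$, for parameters $\xi_{k;j}\in\mathbb R$ ($1\le k\le m$, $1\le j\le r_k$) and for a density operator $\hat\rho$ on $m$ modes, put $$P(y_1,\dots,y_m|\hat\rho)=\mathrm{tr}\Big[\hat\rho\bigotimes_{k=1}^m|y_k\rangle\langle y_k|\Big],\qquad \tilde P_{\xi}(y_1,\dots,y_m|\hat\rho)=\mathrm{tr}\Big[\hat\rho\bigotimes_{k=1}^m|\tilde y_k\rangle\langle\tilde y_k|\Big].$$ **Theorem.** To every state $|y\rangle$ of finite stellar rank $r$ described as above one can assign real polynomials $p_{y;1},\dots,p_{y;r}$ in two variables such that the following holds for all $m$, all finite-stellar-rank states $|y_1\rangle,\dots,|y_m\rangle$ and all $\varepsilon>0$. The numbers $\xi_{k;j}=p_{y_k;j}\big(\varepsilon,\tfrac1m\big)$ are strictly positive, the vectors $|y_k\rangle$ are unit vectors, the vectors $|\tilde y_k\rangle$ have finite norm, and for every density operator $\hat\rho$ on $m$ modes $$\big|P(y_1,\dots,y_m|\hat\rho)-\tilde P_{\xi}(y_1,\dots,y_m|\hat\rho)\big|\le\varepsilon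 .$$ -/

import Mathlib

open scoped Matrix

noncomputable section

namespace BosonicSampling

/-! ### Single-mode operators in the Fock basis

A single-mode vector is written through its Fock amplitudes `ψ : ℕ → ℂ`, that is `∑ n, ψ n |n⟩`,
and a single-mode operator through its matrix `M m n = ⟨m| M |n⟩`. -/

/-- Action of an operator, given by its Fock matrix, on Fock amplitudes. -/
def applyOp (M : Matrix ℕ ℕ ℂ) (ψ : ℕ → ℂ) : ℕ → ℂ :=
  fun m => ∑' n, M m n * ψ n

/-- The vacuum `|0⟩`. -/
def vacuum : ℕ → ℂ := Pi.single 0 1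

/-- The creation operator, `a† |n⟩ = √(n+1) |n+1⟩`. -/
def creation (ψ : ℕ → ℂ) : ℕ → ℂ
  | 0 => 0
  | n + 1 => (Real.sqrt (n + 1) : ℂ) * ψ n

/-- The attenuation `(cosh ξ)^(-a†a)`, `|n⟩ ↦ (cosh ξ)^(-n) |n⟩`. -/
def attenuation (ξ : ℝ) (ψ : ℕ → ℂ) : ℕ → ℂ :=
  fun n => (((Real.cosh ξ ^ n)⁻¹ : ℝ) : ℂ) * ψ n

/-- The Fock matrix of `exp (c (a†)^s)` for `s ≥ 1`:
`exp (c (a†)^s) |n⟩ = ∑ k, c^k / k! √((n + s k)! / n!) |n + s k⟩`. -/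
def raiseExp (s : ℕ) (c : ℂ) : Matrix ℕ ℕ ℂ :=
  fun m n => ∑ k ∈ Finset.range (m + 1),
    if n + s * k = m then
      c ^ k / (k.factorial : ℂ) * (Real.sqrt ((m.factorial : ℝ) / (n.factorial : ℝ)) : ℂ)
    else 0

/-- The Fock matrix of `exp (c a^s)` for `s ≥ 1`. The matrix of `a` is the transpose of the
matrix of `a†`. -/
def lowerExp (s : ℕ) (c : ℂ) : Matrix ℕ ℕ ℂ := (raiseExp s c)ᵀ

/-- The Fock matrix of the displacement operator `D(β) = exp (β a† - β̄ a)`, in the normally ordered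
form `D(β) = exp (-|β|²/2) exp (β a†) exp (-β̄ a)`. The intermediate sum over `l` is finite because
`exp (c a)` maps `|n⟩` to a combination of the `|l⟩` with `l ≤ n`. -/
def displacement (β : ℂ) : Matrix ℕ ℕ ℂ :=
  fun m n => (Real.exp (-‖β‖ ^ 2 / 2) : ℂ) *
    ∑ l ∈ Finset.range (n + 1), raiseExp 1 β m l * lowerExp 1 (-(starRingEnd ℂ) β) l n

/-- `e^{iθ} tanh r` for the squeezing parameter `z = r e^{iθ}`. -/
def squeezeTanh (z : ℂ) : ℂ := Complex.exp (Complex.arg z * Complex.I) * (Real.tanh ‖z‖ : ℂ)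

/-- The Fock matrix of the squeezing operator `S(z) = exp ((z̄ a² - z (a†)²) / 2)`, in the normally
ordered form, with `z = r e^{iθ}` and `τ = e^{iθ} tanh r`,
`S(z) = exp (-τ (a†)² / 2) (cosh r)^(-(a†a + 1/2)) exp (τ̄ a² / 2)`. -/
def squeezing (z : ℂ) : Matrix ℕ ℕ ℂ :=
  fun m n => (((Real.sqrt (Real.cosh ‖z‖))⁻¹ : ℝ) : ℂ) *
    ∑ l ∈ Finset.range (n + 1), raiseExp 2 (-squeezeTanh z / 2) m l *
      (((Real.cosh ‖z‖ ^ l)⁻¹ : ℝ) : ℂ) * lowerExp 2 ((starRingEnd ℂ) (squeezeTanh z) / 2) l n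

/-- The coherent state `|α⟩ = D(α) |0⟩`. -/
def coherent (α : ℂ) : ℕ → ℂ := applyOp (displacement α) vacuum

/-! ### Detector states of finite stellar rank -/

/-- The data of a single-mode pure state of finite stellar rank: the number `rank` of photon
additions (the stellar rank), the displacements `β j` of the photon additions, in the order in
which the additions are applied, and the squeezing parameter `z` and amplitude `α` of the
underlying Gaussian state `S(z) |α⟩`. -/
structure Detector where
  /-- the stellar rank -/
  rank : ℕ
  /-- the displacement parameters of the photon additions -/
  β : Fin rank → ℂ
  /-- the squeezing parameter -/
  z : ℂ
  /-- the amplitude of the coherent state -/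
  α : ℂ

namespace Detector

/-- The Gaussian state `S(z) |α⟩`. -/
def gaussian (d : Detector) : ℕ → ℂ := applyOp (squeezing d.z) (coherent d.α)

/-- The vector `[∏ j, D(β j) A_j D(β j)†] S(z) |α⟩`, where the factor with `j = 0` acts first. -/
def build (d : Detector) (A : Fin d.rank → (ℕ → ℂ) → (ℕ → ℂ)) : ℕ → ℂ :=
  Fin.foldl d.rank
    (fun ψ j => applyOp (displacement (d.β j)) (A j (applyOp (displacement (d.β j))ᴴ ψ)))
    d.gaussian

/-- The normalisation factor: squared norm of `[∏ j, D(β j) a† D(β j)†] S(z) |α⟩`. -/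
def normFactor (d : Detector) : ℝ := ∑' n, ‖d.build (fun _ => creation) n‖ ^ 2

/-- The detector state `|y⟩ = 𝒩^(-1/2) [∏ j, D(β j) a† D(β j)†] S(z) |α⟩`. -/
def state (d : Detector) : ℕ → ℂ :=
  fun n => (((Real.sqrt d.normFactor)⁻¹ : ℝ) : ℂ) * d.build (fun _ => creation) n

/-- The unnormalised vector `|ỹ⟩`: every photon addition `a†` of `|y⟩` is replaced by the attenuated
addition `a† (cosh ξ_j)^(-a†a)`, with the same factor `𝒩^(-1/2)` as in `|y⟩`. -/
def attenuatedState (d : Detector) (ξ : Fin d.rank → ℝ) : ℕ → ℂ :=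
  fun n => (((Real.sqrt d.normFactor)⁻¹ : ℝ) : ℂ) *
    d.build (fun j ψ => creation (attenuation (ξ j) ψ)) n

end Detector

/-! ### Several modes -/

/-- The Hilbert space of `m` modes, with Fock basis indexed by the photon numbers `Fin m → ℕ`. -/
abbrev Modes (m : ℕ) : Type := lp (fun _ : Fin m → ℕ => ℂ) 2

/-- The Fock state `|n₁, …, n_m⟩`. -/
def fock {m : ℕ} (n : Fin m → ℕ) : Modes m := lp.single 2 n 1

/-- The trace, computed in the Fock basis. -/
def trace {m : ℕ} (A : Modes m →L[ℂ] Modes m) : ℂ := ∑' n, inner ℂ (fock n) (A (fock n))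

/-- A density operator on `m` modes: positive, of trace one. For a positive operator the
convergence of the diagonal sum is the trace-class property. -/
structure DensityOperator (m : ℕ) where
  /-- the underlying operator -/
  op : Modes m →L[ℂ] Modes m
  isPositive : op.IsPositive
  trace_eq_one : HasSum (fun n : Fin m → ℕ => inner ℂ (fock n) (op (fock n))) 1

/-- The product vector `⨂ k, ψ k`, with amplitudes `∏ k, ψ k (n k)`. The default value `0` is never
met for square-summable factors `ψ k`. -/
def productVector {m : ℕ} (ψ : Fin m → ℕ → ℂ) : Modes m :=
  open Classical in
  if h : Memℓp (fun n : Fin m → ℕ => ∏ k, ψ k (n k)) 2 then ⟨_, h⟩ else 0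

/-- `tr [ρ ⨂ k, |ψ k⟩⟨ψ k|]`. -/
def bornWeight {m : ℕ} (ρ : DensityOperator m) (ψ : Fin m → ℕ → ℂ) : ℂ :=
  trace (ρ.op ∘L InnerProductSpace.rankOne ℂ (productVector ψ) (productVector ψ))

/-- The outcome probability `P(y₁, …, y_m | ρ) = tr [ρ ⨂ k, |y_k⟩⟨y_k|]`. -/
def outcomeProb {m : ℕ} (d : Fin m → Detector) (ρ : DensityOperator m) : ℂ :=
  bornWeight ρ fun k => (d k).state

/-- The approximate outcome probability `P̃_ξ(y₁, …, y_m | ρ) = tr [ρ ⨂ k, |ỹ_k⟩⟨ỹ_k|]`. -/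
def approxProb {m : ℕ} (d : Fin m → Detector) (ξ : ∀ k, Fin (d k).rank → ℝ)
    (ρ : DensityOperator m) : ℂ :=
  bornWeight ρ fun k => (d k).attenuatedState (ξ k)

end BosonicSampling

end

noncomputable section

namespace BosonicSampling

open Finset

/-! ### Square-summable sequences -/

/-! The polynomials are `c_j · ε · (1/m)` with constants `c_j > 0` depending only on the detector.
With `u = ε/m`, each mode needs two facts for every `u > 0`: the attenuated vector has norm at most
1, and it is within `u/2` of the exact state (`exists_attenuation_rates`). Errors of the `m` tensor
factors then add up without amplification (`norm_tensor_sub_le`), and `ρ = B†B` with `B` a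
contraction costs a factor 2 (`norm_inner_sub_inner_le`).

The norm bound is the delicate fact, since a perturbed input of `a†` may come out longer. The rates
are therefore hierarchical (`exists_rates`): each new addition is attenuated at rate `u`, all
earlier ones at rates scaled down by a small `δ`. Attenuating the last addition lowers the norm by
at least a constant times `u²`, because its input is not a multiple of the vacuum; the earlier ones
disturb that input by only `O(δ²u²)`. For large `u` the attenuated addition is a contraction
outright. The error is `O(u²)` and, by the norm bound, also bounded; together these give a linear
bound for all `u`.

As `a†` is unbounded, estimates run in the weighted norms with square `∑ (n+1)^k |ψ n|²`.
Displacements are bounded in each of them (`exists_nrm_disp_le`), and the Gaussian state has them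
all finite (`gaussian_mem`). -/

lemma memlp_two_iff {ι : Type*} {f : ι → ℂ} :
    Memℓp f 2 ↔ Summable fun i => ‖f i‖ ^ 2 := by
  rw [memℓp_gen_iff (by norm_num)]
  norm_num

lemma lp_hasSum_norm_sq {ι : Type*} (f : lp (fun _ : ι => ℂ) 2) :
    HasSum (fun i => ‖f i‖ ^ 2) (‖f‖ ^ 2) := by
  have h := lp.hasSum_norm (p := 2) (by norm_num) f
  simpa using h

/-! ### Rapidly decreasing Fock amplitudes -/

/-- The rapidly decreasing sequences of Fock amplitudes. -/
def rapidDecay : Submodule ℂ (ℕ → ℂ) where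
  carrier := {ψ | ∀ k : ℕ, Summable fun n : ℕ => ((n : ℝ) + 1) ^ k * ‖ψ n‖ ^ 2}
  zero_mem' := fun k => by simp
  add_mem' := by
    intro ψ φ hψ hφ k
    refine Summable.of_nonneg_of_le (fun n => by positivity) (fun n => ?_)
      (((hψ k).add (hφ k)).mul_left 2)
    have h1 : ‖ψ n + φ n‖ ^ 2 ≤ 2 * (‖ψ n‖ ^ 2 + ‖φ n‖ ^ 2) := by
      have := norm_add_le (ψ n) (φ n)
      nlinarith [sq_nonneg (‖ψ n‖ - ‖φ n‖), norm_nonneg (ψ n + φ n)]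
    have h2 : (0 : ℝ) ≤ ((n : ℝ) + 1) ^ k := by positivity
    calc _ ≤ ((n : ℝ) + 1) ^ k * (2 * (‖ψ n‖ ^ 2 + ‖φ n‖ ^ 2)) :=
          mul_le_mul_of_nonneg_left h1 h2
      _ = _ := by ring
  smul_mem' := by
    intro c ψ hψ k
    refine ((hψ k).mul_left (‖c‖ ^ 2)).congr fun n => ?_
    simp only [Pi.smul_apply, smul_eq_mul, norm_mul]
    ring

lemma norm_weight_mul_sq (k n : ℕ) (c : ℂ) :
    ‖((Real.sqrt (((n : ℝ) + 1) ^ k) : ℝ) : ℂ) * c‖ ^ 2 = ((n : ℝ) + 1) ^ k * ‖c‖ ^ 2 := by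
  rw [norm_mul, mul_pow, Complex.norm_real, Real.norm_eq_abs, sq_abs,
    Real.sq_sqrt (by positivity)]

/-- The square-summable sequence `√((n+1)^k) ψ n`. -/
def weighted (k : ℕ) : rapidDecay →ₗ[ℂ] lp (fun _ : ℕ => ℂ) 2 where
  toFun ψ := ⟨fun n => ((Real.sqrt (((n : ℝ) + 1) ^ k) : ℝ) : ℂ) * ψ.1 n, memlp_two_iff.2 (by
    simpa only [norm_weight_mul_sq] using ψ.2 k)⟩
  map_add' ψ φ := by
    ext n
    exact mul_add _ _ _
  map_smul' c ψ := by
    ext n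
    exact mul_left_comm _ _ _

/-- The weighted norm, with square `∑ n, (n+1)^k |ψ n|²`. -/
def nrm (k : ℕ) (ψ : rapidDecay) : ℝ := ‖weighted k ψ‖

lemma nrm_nonneg (k : ℕ) (ψ : rapidDecay) : 0 ≤ nrm k ψ := norm_nonneg _

lemma nrm_hasSum (k : ℕ) (ψ : rapidDecay) :
    HasSum (fun n : ℕ => ((n : ℝ) + 1) ^ k * ‖ψ.1 n‖ ^ 2) (nrm k ψ ^ 2) := by
  have h := lp_hasSum_norm_sq (weighted k ψ)
  simp only [← norm_weight_mul_sq]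
  exact h

lemma nrm_zero_hasSum (ψ : rapidDecay) :
    HasSum (fun n => ‖ψ.1 n‖ ^ 2) (nrm 0 ψ ^ 2) := by
  simpa using nrm_hasSum 0 ψ

lemma nrm_add_le (k : ℕ) (ψ φ : rapidDecay) : nrm k (ψ + φ) ≤ nrm k ψ + nrm k φ := by
  unfold nrm
  rw [map_add]
  exact norm_add_le _ _

lemma nrm_sub_le (k : ℕ) (ψ φ : rapidDecay) : nrm k (ψ - φ) ≤ nrm k ψ + nrm k φ := by
  unfold nrm
  rw [map_sub]
  exact norm_sub_le _ _

lemma nrm_smul (k : ℕ) (c : ℂ) (ψ : rapidDecay) : nrm k (c • ψ) = ‖c‖ * nrm k ψ := by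
  unfold nrm
  rw [map_smul, norm_smul]

@[simp] lemma nrm_zero (k : ℕ) : nrm k 0 = 0 := by
  unfold nrm
  rw [map_zero, norm_zero]

lemma nrm_eq_zero {ψ : rapidDecay} (h : nrm 0 ψ = 0) : ψ = 0 := by
  have h1 := nrm_zero_hasSum ψ
  rw [h, zero_pow two_ne_zero, hasSum_zero_iff_of_nonneg (fun n => by positivity)] at h1
  ext n
  simpa using congrFun h1 n

lemma nrm_le_of_forall_le {k l : ℕ} {ψ φ : rapidDecay} {K : ℝ} (hK : 0 ≤ K)
    (h : ∀ n : ℕ, ((n : ℝ) + 1) ^ k * ‖ψ.1 n‖ ^ 2 ≤ K ^ 2 * (((n : ℝ) + 1) ^ l * ‖φ.1 n‖ ^ 2)) :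
    nrm k ψ ≤ K * nrm l φ := by
  refine le_of_pow_le_pow_left₀ two_ne_zero (mul_nonneg hK (nrm_nonneg _ _)) ?_
  rw [mul_pow]
  exact hasSum_le h (nrm_hasSum k ψ) ((nrm_hasSum l φ).mul_left _)

lemma nrm_mono {k l : ℕ} (h : k ≤ l) (ψ : rapidDecay) : nrm k ψ ≤ nrm l ψ := by
  have := nrm_le_of_forall_le (k := k) (l := l) (ψ := ψ) (φ := ψ) zero_le_one (fun n => by
    rw [one_pow, one_mul]
    gcongr
    linarith [n.cast_nonneg (α := ℝ)])
  simpa using this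

/-! ### Creation and attenuation -/

lemma norm_creation_succ_sq (ψ : ℕ → ℂ) (n : ℕ) :
    ‖creation ψ (n + 1)‖ ^ 2 = ((n : ℝ) + 1) * ‖ψ n‖ ^ 2 := by
  rw [creation, norm_mul, mul_pow, Complex.norm_real, Real.norm_eq_abs, sq_abs,
    Real.sq_sqrt (by positivity)]

lemma weight_succ_le (k n : ℕ) (c : ℂ) :
    (((n + 1 : ℕ) : ℝ) + 1) ^ k * (((n : ℝ) + 1) * ‖c‖ ^ 2) ≤
      2 ^ k * (((n : ℝ) + 1) ^ (k + 1) * ‖c‖ ^ 2) := by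
  have h : (((n + 1 : ℕ) : ℝ) + 1) ^ k ≤ (2 * ((n : ℝ) + 1)) ^ k := by
    gcongr
    push_cast
    linarith [n.cast_nonneg (α := ℝ)]
  calc _ ≤ (2 * ((n : ℝ) + 1)) ^ k * (((n : ℝ) + 1) * ‖c‖ ^ 2) := by gcongr
    _ = _ := by rw [mul_pow]; ring

lemma creation_mem {ψ : ℕ → ℂ} (hψ : ψ ∈ rapidDecay) : creation ψ ∈ rapidDecay := by
  intro k
  rw [← summable_nat_add_iff 1]
  refine Summable.of_nonneg_of_le (fun n => by positivity) (fun n => ?_)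
    ((hψ (k + 1)).mul_left (2 ^ k))
  rw [norm_creation_succ_sq]
  exact weight_succ_le k n _

/-- The creation operator on rapidly decreasing sequences. -/
def cre : rapidDecay →ₗ[ℂ] rapidDecay where
  toFun ψ := ⟨creation ψ, creation_mem ψ.2⟩
  map_add' ψ φ := by
    ext n
    cases n <;> simp [creation, mul_add]
  map_smul' c ψ := by
    ext n
    cases n <;> simp [creation]
    ring

lemma cre_hasSum (k : ℕ) (ψ : rapidDecay) :
    HasSum (fun n : ℕ => (((n + 1 : ℕ) : ℝ) + 1) ^ k * (((n : ℝ) + 1) * ‖ψ.1 n‖ ^ 2))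
      (nrm k (cre ψ) ^ 2) := by
  have h := (hasSum_nat_add_iff' 1).2 (nrm_hasSum k (cre ψ))
  have h0 : ‖(cre ψ).1 0‖ = 0 := norm_zero
  rw [range_one, sum_singleton, h0, zero_pow two_ne_zero, mul_zero, sub_zero] at h
  simp only [← norm_creation_succ_sq]
  exact h

lemma cre_zero_hasSum (ψ : rapidDecay) :
    HasSum (fun n : ℕ => ((n : ℝ) + 1) * ‖ψ.1 n‖ ^ 2) (nrm 0 (cre ψ) ^ 2) := by
  simpa using cre_hasSum 0 ψ

lemma nrm_cre_le (k : ℕ) (ψ : rapidDecay) : nrm k (cre ψ) ≤ 2 ^ k * nrm (k + 1) ψ := by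
  refine le_of_pow_le_pow_left₀ two_ne_zero (mul_nonneg (by positivity) (nrm_nonneg _ _)) ?_
  -- The squared norms give the constant `2^k`; squaring it is wasteful but avoids a square root in
  -- the statement.
  have h1 : (2 : ℝ) ^ k ≤ (2 ^ k) ^ 2 := by
    have : (1 : ℝ) ≤ 2 ^ k := one_le_pow₀ (by norm_num)
    nlinarith
  calc nrm k (cre ψ) ^ 2 ≤ 2 ^ k * nrm (k + 1) ψ ^ 2 :=
        hasSum_le (fun n => weight_succ_le k n _) (cre_hasSum k ψ)
          ((nrm_hasSum (k + 1) ψ).mul_left _)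
    _ ≤ (2 ^ k) ^ 2 * nrm (k + 1) ψ ^ 2 := by gcongr
    _ = _ := by ring

/-- Since `a a† = a†a + 1 ≥ 1`. This keeps the normalisation factor positive. -/
lemma nrm_le_nrm_cre (ψ : rapidDecay) : nrm 0 ψ ≤ nrm 0 (cre ψ) := by
  refine le_of_pow_le_pow_left₀ two_ne_zero (nrm_nonneg _ _) ?_
  refine hasSum_le (fun n => ?_) (nrm_zero_hasSum ψ) (cre_zero_hasSum ψ)
  nlinarith [sq_nonneg ‖ψ.1 n‖, n.cast_nonneg (α := ℝ)]

lemma inv_cosh_pow_le_one (ξ : ℝ) (n : ℕ) : (Real.cosh ξ ^ n)⁻¹ ≤ 1 :=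
  inv_le_one_of_one_le₀ (one_le_pow₀ (Real.one_le_cosh ξ))

lemma inv_cosh_pow_pos (ξ : ℝ) (n : ℕ) : 0 < (Real.cosh ξ ^ n)⁻¹ :=
  inv_pos.2 (pow_pos (Real.cosh_pos ξ) n)

lemma norm_attenuation_sq (ξ : ℝ) (ψ : ℕ → ℂ) (n : ℕ) :
    ‖attenuation ξ ψ n‖ ^ 2 = ((Real.cosh ξ ^ n)⁻¹) ^ 2 * ‖ψ n‖ ^ 2 := by
  rw [attenuation, norm_mul, mul_pow, Complex.norm_real, Real.norm_eq_abs, sq_abs]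

lemma norm_attenuation_sq_le (ξ : ℝ) (ψ : ℕ → ℂ) (n : ℕ) :
    ‖attenuation ξ ψ n‖ ^ 2 ≤ ‖ψ n‖ ^ 2 := by
  rw [norm_attenuation_sq]
  exact mul_le_of_le_one_left (by positivity)
    (pow_le_one₀ (inv_cosh_pow_pos ξ n).le (inv_cosh_pow_le_one ξ n))

/-- The attenuation on rapidly decreasing sequences. -/
def att (ξ : ℝ) : rapidDecay →ₗ[ℂ] rapidDecay where
  toFun ψ := ⟨attenuation ξ ψ, fun k => Summable.of_nonneg_of_le (fun n => by positivity)
    (fun n => mul_le_mul_of_nonneg_left (norm_attenuation_sq_le ξ ψ n) (by positivity)) (ψ.2 k)⟩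
  map_add' ψ φ := by
    ext n
    simp [attenuation, mul_add]
  map_smul' c ψ := by
    ext n
    simp [attenuation]
    ring

@[simp] lemma att_zero (ψ : rapidDecay) : att 0 ψ = ψ := by
  ext n
  simp [att, attenuation]

lemma nrm_att_le (k : ℕ) (ξ : ℝ) (ψ : rapidDecay) : nrm k (att ξ ψ) ≤ nrm k ψ := by
  simpa using nrm_le_of_forall_le (k := k) (l := k) (ψ := att ξ ψ) (φ := ψ) zero_le_one
    (fun n => by
      rw [one_pow, one_mul]
      exact mul_le_mul_of_nonneg_left (norm_attenuation_sq_le ξ ψ n) (by positivity))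

/-- Combines `cosh ξ ≤ exp (ξ²/2)` with `1 - exp (-x) ≤ x`. Attenuation thus departs from the
identity only at second order in `ξ`. -/
lemma one_sub_inv_cosh_pow_le (ξ : ℝ) (n : ℕ) :
    1 - (Real.cosh ξ ^ n)⁻¹ ≤ ξ ^ 2 * (n + 1) := by
  have h1 : Real.cosh ξ ^ n ≤ Real.exp (n * (ξ ^ 2 / 2)) := by
    rw [Real.exp_nat_mul]
    exact pow_le_pow_left₀ (Real.cosh_pos ξ).le (Real.cosh_le_exp_half_sq ξ) n
  have h2 : Real.exp (-(n * (ξ ^ 2 / 2))) ≤ (Real.cosh ξ ^ n)⁻¹ := by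
    rw [Real.exp_neg]
    exact inv_anti₀ (pow_pos (Real.cosh_pos ξ) n) h1
  have h3 := Real.add_one_le_exp (-(n * (ξ ^ 2 / 2)))
  nlinarith [sq_nonneg ξ, n.cast_nonneg (α := ℝ), mul_nonneg (n.cast_nonneg (α := ℝ)) (sq_nonneg ξ)]

lemma nrm_att_sub_le (k : ℕ) (ξ : ℝ) (ψ : rapidDecay) :
    nrm k (att ξ ψ - ψ) ≤ ξ ^ 2 * nrm (k + 2) ψ := by
  refine nrm_le_of_forall_le (sq_nonneg ξ) fun n => ?_
  have h1 : (att ξ ψ - ψ).1 n = (((Real.cosh ξ ^ n)⁻¹ - 1 : ℝ) : ℂ) * ψ.1 n := by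
    simp [att, attenuation]
    ring
  have h2 : ((Real.cosh ξ ^ n)⁻¹ - 1) ^ 2 ≤ (ξ ^ 2 * (n + 1)) ^ 2 := by
    rw [sq_le_sq, abs_sub_comm, abs_of_nonneg (by linarith [inv_cosh_pow_le_one ξ n])]
    exact (one_sub_inv_cosh_pow_le ξ n).trans (le_abs_self _)
  rw [h1, norm_mul, mul_pow, Complex.norm_real, Real.norm_eq_abs, sq_abs]
  calc _ ≤ ((n : ℝ) + 1) ^ k * ((ξ ^ 2 * (n + 1)) ^ 2 * ‖ψ.1 n‖ ^ 2) := by gcongr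
    _ = _ := by ring

lemma cre_att_hasSum (ξ : ℝ) (ψ : rapidDecay) :
    HasSum (fun n : ℕ => ((n : ℝ) + 1) * (((Real.cosh ξ ^ n)⁻¹) ^ 2 * ‖ψ.1 n‖ ^ 2))
      (nrm 0 (cre (att ξ ψ)) ^ 2) := by
  simpa only [att, LinearMap.coe_mk, AddHom.coe_mk, norm_attenuation_sq]
    using cre_zero_hasSum (att ξ ψ)

lemma nrm_cre_att_le (ξ : ℝ) (ψ : rapidDecay) : nrm 0 (cre (att ξ ψ)) ≤ nrm 0 (cre ψ) := by
  refine le_of_pow_le_pow_left₀ two_ne_zero (nrm_nonneg _ _) ?_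
  refine hasSum_le (fun n => ?_) (cre_att_hasSum ξ ψ) (cre_zero_hasSum ψ)
  have := norm_attenuation_sq_le ξ ψ.1 n
  rw [norm_attenuation_sq] at this
  gcongr

/-- A strongly attenuated photon addition is a contraction. -/
lemma nrm_cre_att_le_of_two_le {ξ : ℝ} (h : 2 ≤ Real.cosh ξ ^ 2) (ψ : rapidDecay) :
    nrm 0 (cre (att ξ ψ)) ≤ nrm 0 ψ := by
  refine le_of_pow_le_pow_left₀ two_ne_zero (nrm_nonneg _ _) ?_
  refine hasSum_le (fun n => ?_) (cre_att_hasSum ξ ψ) (nrm_zero_hasSum ψ)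
  rw [← mul_assoc]
  refine mul_le_of_le_one_left (by positivity) ?_
  rw [inv_pow, ← div_eq_mul_inv, div_le_one (by have := Real.cosh_pos ξ; positivity), ← pow_mul,
    mul_comm n 2, pow_mul]
  have h1 : ((n : ℝ) + 1) ≤ 2 ^ n := by exact_mod_cast Nat.lt_two_pow_self
  exact h1.trans (pow_le_pow_left₀ (by norm_num) h n)

/-- The photon number `m` component bounds the loss of norm from the attenuation. -/
lemma nrm_cre_att_sq_le (ξ : ℝ) (ψ : rapidDecay) {m : ℕ} (hm : 1 ≤ m) :
    nrm 0 (cre (att ξ ψ)) ^ 2 ≤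
      nrm 0 (cre ψ) ^ 2 - (1 - (Real.cosh ξ ^ 2)⁻¹) * ‖ψ.1 m‖ ^ 2 := by
  have h1 := (cre_zero_hasSum ψ).sub (cre_att_hasSum ξ ψ)
  have h2 := le_hasSum h1 m fun n _ => by
    have := norm_attenuation_sq_le ξ ψ.1 n
    rw [norm_attenuation_sq] at this
    rw [← mul_sub]
    exact mul_nonneg (by positivity) (by linarith)
  -- Here `m ≥ 1` is essential: the vacuum component is not attenuated at all.
  have h3 : ((Real.cosh ξ ^ m)⁻¹) ^ 2 ≤ (Real.cosh ξ ^ 2)⁻¹ := by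
    rw [inv_pow, ← pow_mul]
    exact inv_anti₀ (pow_pos (Real.cosh_pos ξ) 2)
      (pow_le_pow_right₀ (Real.one_le_cosh ξ) (by omega))
  have h4 : (Real.cosh ξ ^ 2)⁻¹ ≤ 1 := inv_cosh_pow_le_one ξ 2
  have h5 : (1 - (Real.cosh ξ ^ 2)⁻¹) * ‖ψ.1 m‖ ^ 2 ≤
      ((m : ℝ) + 1) * ((1 - ((Real.cosh ξ ^ m)⁻¹) ^ 2) * ‖ψ.1 m‖ ^ 2) := by
    have h6 : (1 - (Real.cosh ξ ^ 2)⁻¹) * ‖ψ.1 m‖ ^ 2 ≤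
        (1 - ((Real.cosh ξ ^ m)⁻¹) ^ 2) * ‖ψ.1 m‖ ^ 2 := by gcongr
    have h7 : 0 ≤ (1 - (Real.cosh ξ ^ 2)⁻¹) * ‖ψ.1 m‖ ^ 2 :=
      mul_nonneg (by linarith) (by positivity)
    nlinarith [m.cast_nonneg (α := ℝ)]
  nlinarith

/-! ### Matrix elements of the displacement operator -/

lemma raiseExp_one_apply (c : ℂ) (m n : ℕ) :
    raiseExp 1 c m n = if n ≤ m then
      c ^ (m - n) / ((m - n).factorial : ℂ) *
        ((Real.sqrt m.factorial / Real.sqrt n.factorial : ℝ) : ℂ) else 0 := by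
  rw [raiseExp]
  split_ifs with h
  · rw [sum_eq_single (m - n)]
    · rw [if_pos (by omega), Real.sqrt_div (by positivity)]
    · intro k _ hk
      rw [if_neg (by omega)]
    · intro hk
      simp at hk
  · exact sum_eq_zero fun k _ => if_neg (by omega)

lemma sqrt_factorial_succ (n : ℕ) :
    Real.sqrt (n + 1).factorial = Real.sqrt ((n : ℝ) + 1) * Real.sqrt n.factorial := by
  rw [Nat.factorial_succ, Nat.cast_mul, Real.sqrt_mul (by positivity)]
  push_cast
  rfl

lemma sqrt_factorial_pos (n : ℕ) : 0 < Real.sqrt (n.factorial : ℝ) :=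
  Real.sqrt_pos.2 (by exact_mod_cast n.factorial_pos)

lemma sqrt_succ_pos (n : ℕ) : 0 < Real.sqrt ((n : ℝ) + 1) := Real.sqrt_pos.2 (by positivity)

lemma sqrt_succ_mul_self (n : ℕ) :
    (Real.sqrt ((n : ℝ) + 1) : ℂ) * (Real.sqrt ((n : ℝ) + 1) : ℂ) = n + 1 := by
  rw [← Complex.ofReal_mul, Real.mul_self_sqrt (by positivity)]
  push_cast
  rfl

/-- Matrix form of the fact that `exp (c a†)` commutes with `a†`. -/
lemma raiseExp_one_succ_succ (c : ℂ) (m n : ℕ) :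
    (Real.sqrt (n + 1) : ℂ) * raiseExp 1 c (m + 1) (n + 1) =
      (Real.sqrt (m + 1) : ℂ) * raiseExp 1 c m n := by
  have h1 : (Real.sqrt n.factorial : ℂ) ≠ 0 := by exact_mod_cast (sqrt_factorial_pos n).ne'
  have h2 : (Real.sqrt (n + 1) : ℂ) ≠ 0 := by exact_mod_cast (sqrt_succ_pos n).ne'
  simp only [raiseExp_one_apply, Nat.add_le_add_iff_right, Nat.add_sub_add_right]
  split_ifs with h
  · rw [sqrt_factorial_succ, sqrt_factorial_succ]
    push_cast
    field_simp
  · simp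

lemma raiseExp_one_zero_right (c : ℂ) (m : ℕ) :
    raiseExp 1 c m 0 = c ^ m / (Real.sqrt m.factorial : ℂ) := by
  have h2 : (m.factorial : ℂ) = (Real.sqrt m.factorial : ℂ) * (Real.sqrt m.factorial : ℂ) := by
    rw [← Complex.ofReal_mul, Real.mul_self_sqrt (by positivity)]
    simp
  have h1 : (Real.sqrt m.factorial : ℂ) ≠ 0 := by exact_mod_cast (sqrt_factorial_pos m).ne'
  rw [raiseExp_one_apply, if_pos (Nat.zero_le _), Nat.sub_zero, h2]
  simp only [Nat.factorial_zero, Nat.cast_one, Real.sqrt_one, div_one]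
  field_simp

lemma raiseExp_one_succ_zero (c : ℂ) (m : ℕ) :
    (Real.sqrt (m + 1) : ℂ) * raiseExp 1 c (m + 1) 0 = c * raiseExp 1 c m 0 := by
  have h1 : (Real.sqrt m.factorial : ℂ) ≠ 0 := by exact_mod_cast (sqrt_factorial_pos m).ne'
  have h2 : (Real.sqrt (m + 1) : ℂ) ≠ 0 := by exact_mod_cast (sqrt_succ_pos m).ne'
  rw [raiseExp_one_zero_right, raiseExp_one_zero_right, sqrt_factorial_succ]
  push_cast
  field_simp
  ring

/-- The relation `a exp (c a†) = exp (c a†) (a + c)`. -/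
lemma raiseExp_one_lower (c : ℂ) (m n : ℕ) :
    (Real.sqrt (m + 1) : ℂ) * raiseExp 1 c (m + 1) (n + 1) =
      (Real.sqrt (n + 1) : ℂ) * raiseExp 1 c m n + c * raiseExp 1 c m (n + 1) := by
  have hn : (Real.sqrt (n + 1) : ℂ) ≠ 0 := by exact_mod_cast (sqrt_succ_pos n).ne'
  have hs := raiseExp_one_succ_succ c m n
  have hm := sqrt_succ_mul_self m
  have hn2 := sqrt_succ_mul_self n
  apply mul_left_cancel₀ hn
  rw [mul_left_comm, hs, ← mul_assoc, hm, mul_add, ← mul_assoc, hn2]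
  -- With `m - n = k + 1`, this is `c · c^k / k! = (k + 1) · c^(k+1) / (k+1)!`; both sides vanish
  -- for `m ≤ n`.
  have key : (Real.sqrt (n + 1) : ℂ) * (c * raiseExp 1 c m (n + 1)) =
      ((m : ℂ) - n) * raiseExp 1 c m n := by
    have h1 : (Real.sqrt n.factorial : ℂ) ≠ 0 := by exact_mod_cast (sqrt_factorial_pos n).ne'
    simp only [raiseExp_one_apply]
    rcases lt_trichotomy m n with h | h | h
    · rw [if_neg (by omega), if_neg (by omega)]
      simp
    · subst h
      rw [if_neg (by omega)]
      simp
    · obtain ⟨k, rfl⟩ := Nat.exists_eq_add_of_lt h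
      rw [if_pos (by omega), if_pos (by omega), show n + k + 1 - (n + 1) = k by omega,
        show n + k + 1 - n = k + 1 by omega, sqrt_factorial_succ n, Nat.factorial_succ k]
      have hk : ((k : ℂ) + 1) ≠ 0 := by exact_mod_cast k.succ_ne_zero
      have hk2 : (k.factorial : ℂ) ≠ 0 := by exact_mod_cast k.factorial_ne_zero
      push_cast
      field_simp
      ring
  rw [key]
  ring

lemma displacement_apply (β : ℂ) (m n : ℕ) :
    displacement β m n = (Real.exp (-‖β‖ ^ 2 / 2) : ℂ) *
      ∑ l ∈ range (n + 1), raiseExp 1 β m l * raiseExp 1 (-(starRingEnd ℂ) β) n l := rfl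

lemma displacement_succ_zero (β : ℂ) (m : ℕ) :
    (Real.sqrt (m + 1) : ℂ) * displacement β (m + 1) 0 = β * displacement β m 0 := by
  simp only [displacement_apply, zero_add, range_one, sum_singleton]
  linear_combination ((Real.exp (-‖β‖ ^ 2 / 2) : ℂ) * raiseExp 1 (-(starRingEnd ℂ) β) 0 0) *
    raiseExp_one_succ_zero β m

/-- The relation `a D(β) = D(β) (a + β)`. -/
lemma displacement_lower (β : ℂ) (m n : ℕ) :
    (Real.sqrt (m + 1) : ℂ) * displacement β (m + 1) (n + 1) =
      (Real.sqrt (n + 1) : ℂ) * displacement β m n + β * displacement β m (n + 1) := by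
  simp only [displacement_apply]
  -- The term `l = 0` is split off: it obeys the eigenvector relation on the vacuum, the others the
  -- commutation relations.
  rw [sum_range_succ' _ (n + 1), sum_range_succ' _ (n + 1)]
  have h : (Real.sqrt (m + 1) : ℂ) * ∑ l ∈ range (n + 1),
        raiseExp 1 β (m + 1) (l + 1) * raiseExp 1 (-(starRingEnd ℂ) β) (n + 1) (l + 1) =
      (Real.sqrt (n + 1) : ℂ) * ∑ l ∈ range (n + 1),
        raiseExp 1 β m l * raiseExp 1 (-(starRingEnd ℂ) β) n l +
      β * ∑ l ∈ range (n + 1),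
        raiseExp 1 β m (l + 1) * raiseExp 1 (-(starRingEnd ℂ) β) (n + 1) (l + 1) := by
    rw [mul_sum, mul_sum, mul_sum, ← sum_add_distrib]
    refine sum_congr rfl fun l _ => ?_
    linear_combination raiseExp 1 (-(starRingEnd ℂ) β) (n + 1) (l + 1) * raiseExp_one_lower β m l +
      raiseExp 1 β m l * raiseExp_one_succ_succ (-(starRingEnd ℂ) β) n l
  linear_combination (Real.exp (-‖β‖ ^ 2 / 2) : ℂ) * h +
    ((Real.exp (-‖β‖ ^ 2 / 2) : ℂ) * raiseExp 1 (-(starRingEnd ℂ) β) (n + 1) 0) *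
    raiseExp_one_succ_zero β m

lemma displacement_lower' (β : ℂ) (m n : ℕ) :
    (Real.sqrt (m + 1) : ℂ) * displacement β (m + 1) n =
      (Real.sqrt n : ℂ) * displacement β m (n - 1) + β * displacement β m n := by
  cases n with
  | zero => simpa using displacement_succ_zero β m
  | succ n => simpa using displacement_lower β m n

lemma displacement_eq_sum_of_le (β : ℂ) {m n N : ℕ} (h : n ≤ N) :
    displacement β m n = (Real.exp (-‖β‖ ^ 2 / 2) : ℂ) *
      ∑ l ∈ range (N + 1), raiseExp 1 β m l * raiseExp 1 (-(starRingEnd ℂ) β) n l := by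
  rw [displacement_apply]
  congr 1
  refine sum_subset (range_mono (by omega)) fun l _ hl => ?_
  rw [raiseExp_one_apply _ n l, if_neg, mul_zero]
  simp at hl
  omega

lemma star_raiseExp (s : ℕ) (c : ℂ) (m n : ℕ) :
    (starRingEnd ℂ) (raiseExp s c m n) = raiseExp s ((starRingEnd ℂ) c) m n := by
  simp only [raiseExp, map_sum]
  refine sum_congr rfl fun k _ => ?_
  split_ifs <;> simp

lemma star_displacement (β : ℂ) (m n : ℕ) :
    (starRingEnd ℂ) (displacement β n m) = displacement (-β) m n := by
  -- The intermediate sums stop at `n` and at `m` respectively; a common cutoff makes them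
  -- comparable term by term.
  rw [displacement_eq_sum_of_le β (le_max_left m n),
    displacement_eq_sum_of_le (-β) (le_max_right m n)]
  simp only [map_mul, map_sum, star_raiseExp, Complex.conj_ofReal, norm_neg, map_neg, neg_neg,
    Complex.conj_conj]
  congr 1
  exact sum_congr rfl fun l _ => mul_comm _ _

lemma conjTranspose_displacement (β : ℂ) : (displacement β)ᴴ = displacement (-β) := by
  ext m n
  rw [Matrix.conjTranspose_apply]
  exact star_displacement β m n

/-- The relation `D(β) a† = (a† - β̄) D(β)`. -/
lemma displacement_raise (β : ℂ) (m n : ℕ) :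
    (Real.sqrt (n + 1) : ℂ) * displacement β m (n + 1) =
      creation (fun m => displacement β m n) m - (starRingEnd ℂ) β * displacement β m n := by
  have h := congrArg (starRingEnd ℂ) (displacement_lower' (-β) n m)
  simp only [map_add, map_mul, star_displacement, Complex.conj_ofReal, neg_neg, map_neg] at h
  rw [h]
  cases m with
  | zero => simp [creation]
  | succ m =>
    simp only [creation, Nat.add_sub_cancel]
    push_cast
    ring

lemma displacement_zero_right (β : ℂ) (m : ℕ) :
    displacement β m 0 = (Real.exp (-‖β‖ ^ 2 / 2) : ℂ) * (β ^ m / (Real.sqrt m.factorial : ℂ)) := by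
  rw [displacement_apply]
  simp [raiseExp_one_zero_right]

lemma norm_displacement_zero_right_sq (β : ℂ) (m : ℕ) :
    ‖displacement β m 0‖ ^ 2 =
      Real.exp (-‖β‖ ^ 2) * ((‖β‖ ^ 2) ^ m / (m.factorial : ℝ)) := by
  rw [displacement_zero_right, norm_mul, norm_div, norm_pow, mul_pow, div_pow, Complex.norm_real,
    Complex.norm_real, Real.norm_eq_abs, Real.norm_eq_abs, sq_abs, sq_abs,
    Real.sq_sqrt (by positivity), ← Real.exp_nat_mul, pow_right_comm]
  congr 2
  push_cast
  ring

lemma hasSum_norm_displacement_zero_right (β : ℂ) :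
    HasSum (fun m => ‖displacement β m 0‖ ^ 2) 1 := by
  have h : HasSum (fun m : ℕ => (‖β‖ ^ 2) ^ m / (m.factorial : ℝ)) (Real.exp (‖β‖ ^ 2)) := by
    rw [Real.exp_eq_exp_ℝ]
    exact NormedSpace.expSeries_div_hasSum_exp (‖β‖ ^ 2)
  have h2 := h.mul_left (Real.exp (-‖β‖ ^ 2))
  rw [← Real.exp_add, neg_add_cancel, Real.exp_zero] at h2
  simpa only [norm_displacement_zero_right_sq] using h2

lemma displacement_zero_right_mem (β : ℂ) :
    (fun m => displacement β m 0) ∈ rapidDecay := by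
  intro k
  simp only [norm_displacement_zero_right_sq]
  -- The polynomial weight is traded for `2^n`, which the Poisson distribution absorbs by doubling
  -- its parameter.
  obtain ⟨C, hC⟩ : ∃ C : ℝ, ∀ n : ℕ, ((n : ℝ) + 1) ^ k ≤ C * 2 ^ n := by
    have h := (tendsto_pow_const_div_const_pow_of_one_lt k (r := (2 : ℝ)) (by norm_num)).comp
      (Filter.tendsto_add_atTop_nat 1)
    obtain ⟨C, hC⟩ := h.bddAbove_range
    refine ⟨2 * C, fun n => ?_⟩
    have h1 := hC ⟨n, rfl⟩
    simp only [Function.comp] at h1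
    rw [div_le_iff₀ (by positivity)] at h1
    push_cast at h1
    rw [pow_succ] at h1
    linarith
  have hs : Summable fun n : ℕ => (2 * ‖β‖ ^ 2) ^ n / (n.factorial : ℝ) :=
    Real.summable_pow_div_factorial _
  refine Summable.of_nonneg_of_le (fun n => by positivity) (fun n => ?_)
    (hs.mul_left (C * Real.exp (-‖β‖ ^ 2)))
  calc _ ≤ C * 2 ^ n * (Real.exp (-‖β‖ ^ 2) * ((‖β‖ ^ 2) ^ n / (n.factorial : ℝ))) := by
        gcongr
        exact hC n
    _ = _ := by
        rw [mul_pow]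
        ring

/-- `D(β) a† = (a† - β̄) D(β)` produces each column from the preceding one by operations that
preserve rapid decay. -/
lemma displacement_mem (β : ℂ) (n : ℕ) : (fun m => displacement β m n) ∈ rapidDecay := by
  induction n with
  | zero => exact displacement_zero_right_mem β
  | succ n ih =>
    have h1 : (Real.sqrt (n + 1) : ℂ) ≠ 0 := by exact_mod_cast (sqrt_succ_pos n).ne'
    have h2 : (fun m => displacement β m (n + 1)) = (Real.sqrt (n + 1) : ℂ)⁻¹ •
        (creation (fun m => displacement β m n) -
          (starRingEnd ℂ) β • fun m => displacement β m n) := by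
      ext m
      simp only [Pi.smul_apply, Pi.sub_apply, smul_eq_mul]
      rw [← displacement_raise, inv_mul_cancel_left₀ h1]
    rw [h2]
    exact rapidDecay.smul_mem _ (rapidDecay.sub_mem (creation_mem ih) (rapidDecay.smul_mem _ ih))

/-- The displaced Fock state `D(β) |n⟩`. -/
def displacedFock (β : ℂ) (n : ℕ) : rapidDecay := ⟨_, displacement_mem β n⟩

lemma displacedFock_apply (β : ℂ) (n m : ℕ) :
    (displacedFock β n).1 m = displacement β m n := rfl

/-! ### The annihilation operator -/

lemma norm_sqrt_succ_mul_sq (n : ℕ) (c : ℂ) :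
    ‖(Real.sqrt (n + 1) : ℂ) * c‖ ^ 2 = ((n : ℝ) + 1) * ‖c‖ ^ 2 := by
  rw [norm_mul, mul_pow, Complex.norm_real, Real.norm_eq_abs, sq_abs,
    Real.sq_sqrt (by positivity)]

lemma weight_ann_le (k n : ℕ) (c : ℂ) :
    ((n : ℝ) + 1) ^ k * (((n : ℝ) + 1) * ‖c‖ ^ 2) ≤
      (((n + 1 : ℕ) : ℝ) + 1) ^ (k + 1) * ‖c‖ ^ 2 := by
  rw [← mul_assoc, ← pow_succ]
  gcongr
  linarith

/-- The annihilation operator on rapidly decreasing sequences. -/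
def ann : rapidDecay →ₗ[ℂ] rapidDecay where
  toFun ψ := ⟨fun n => (Real.sqrt (n + 1) : ℂ) * ψ.1 (n + 1), fun k => by
    simp only [norm_sqrt_succ_mul_sq]
    exact Summable.of_nonneg_of_le (fun n => by positivity) (fun n => weight_ann_le k n _)
      ((summable_nat_add_iff 1).2 (ψ.2 (k + 1)))⟩
  map_add' ψ φ := by
    ext n
    exact mul_add _ _ _
  map_smul' c ψ := by
    ext n
    exact mul_left_comm _ _ _

lemma ann_apply (ψ : rapidDecay) (n : ℕ) :
    (ann ψ).1 n = (Real.sqrt (n + 1) : ℂ) * ψ.1 (n + 1) := rfl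

lemma nrm_ann_le (k : ℕ) (ψ : rapidDecay) : nrm k (ann ψ) ≤ nrm (k + 1) ψ := by
  refine le_of_pow_le_pow_left₀ two_ne_zero (nrm_nonneg _ _) ?_
  have h1 := nrm_hasSum k (ann ψ)
  simp only [ann_apply, norm_sqrt_succ_mul_sq] at h1
  have h2 := (hasSum_nat_add_iff' 1).2 (nrm_hasSum (k + 1) ψ)
  refine (hasSum_le (fun n => weight_ann_le k n _) h1 h2).trans ?_
  rw [range_one, sum_singleton]
  linarith [show (0 : ℝ) ≤ (((0 : ℕ) : ℝ) + 1) ^ (k + 1) * ‖ψ.1 0‖ ^ 2 by positivity]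

lemma weighted_zero_apply (ψ : rapidDecay) (n : ℕ) : weighted 0 ψ n = ψ.1 n := by
  change ((Real.sqrt (((n : ℝ) + 1) ^ 0) : ℝ) : ℂ) * ψ.1 n = ψ.1 n
  simp

/-- The inner product of rapidly decreasing sequences. -/
def ip (φ ψ : rapidDecay) : ℂ := inner ℂ (weighted 0 φ) (weighted 0 ψ)

lemma ip_hasSum (φ ψ : rapidDecay) :
    HasSum (fun n => ψ.1 n * (starRingEnd ℂ) (φ.1 n)) (ip φ ψ) := by
  have h := lp.hasSum_inner (𝕜 := ℂ) (weighted 0 φ) (weighted 0 ψ)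
  simp only [weighted_zero_apply, RCLike.inner_apply] at h
  exact h

lemma ip_cre (φ ψ : rapidDecay) : ip φ (cre ψ) = ip (ann φ) ψ := by
  have h1 := (hasSum_nat_add_iff' 1).2 (ip_hasSum φ (cre ψ))
  have h0 : (cre ψ).1 0 = 0 := rfl
  rw [range_one, sum_singleton, h0, zero_mul, sub_zero] at h1
  refine h1.unique ?_
  have h2 := ip_hasSum (ann φ) ψ
  simp only [ann_apply, map_mul, Complex.conj_ofReal] at h2
  refine h2.congr_fun fun n => ?_
  change (Real.sqrt (n + 1) : ℂ) * ψ.1 n * _ = _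
  ring

lemma ip_conj (φ ψ : rapidDecay) : (starRingEnd ℂ) (ip φ ψ) = ip ψ φ := inner_conj_symm _ _

lemma ann_displacedFock_zero (β : ℂ) : ann (displacedFock β 0) = β • displacedFock β 0 := by
  ext m
  exact displacement_succ_zero β m

lemma ann_displacedFock_succ (β : ℂ) (n : ℕ) :
    ann (displacedFock β (n + 1)) =
      (Real.sqrt (n + 1) : ℂ) • displacedFock β n + β • displacedFock β (n + 1) := by
  ext m
  exact displacement_lower β m n

lemma displacedFock_succ (β : ℂ) (n : ℕ) :
    (Real.sqrt (n + 1) : ℂ) • displacedFock β (n + 1) =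
      cre (displacedFock β n) - (starRingEnd ℂ) β • displacedFock β n := by
  ext m
  exact displacement_raise β m n

lemma ip_displacedFock_succ (β : ℂ) (φ : rapidDecay) (n : ℕ) :
    (Real.sqrt (n + 1) : ℂ) * ip φ (displacedFock β (n + 1)) =
      ip (ann φ - β • φ) (displacedFock β n) := by
  have h := congrArg (ip φ) (displacedFock_succ β n)
  have h1 := ip_cre φ (displacedFock β n)
  simp only [ip, map_sub, map_smul, inner_sub_right, inner_smul_right, inner_sub_left,
    inner_smul_left] at h h1 ⊢
  rw [h, h1]

/-- The operators `a - β` and `a† - β̄` act on displaced Fock states as `a` and `a†` do on Fock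
states, so both indices can be lowered together. What remains is the Poisson normalisation and the
vanishing of `a - β` on the displaced vacuum. -/
lemma ip_displacedFock (β : ℂ) (i j : ℕ) :
    ip (displacedFock β i) (displacedFock β j) = if i = j then 1 else 0 := by
  have h0 : ip (displacedFock β 0) (displacedFock β 0) = 1 := by
    have h1 := (hasSum_norm_displacement_zero_right β).unique (nrm_zero_hasSum (displacedFock β 0))
    unfold ip
    rw [inner_self_eq_norm_sq_to_K]
    change ((nrm 0 (displacedFock β 0) : ℂ)) ^ 2 = 1
    rw [← Complex.ofReal_pow, ← h1, Complex.ofReal_one]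
  have hz : ∀ j, ip (displacedFock β 0) (displacedFock β (j + 1)) = 0 := by
    intro j
    have h := ip_displacedFock_succ β (displacedFock β 0) j
    have h1 : (Real.sqrt (j + 1) : ℂ) ≠ 0 := by exact_mod_cast (sqrt_succ_pos j).ne'
    rw [ann_displacedFock_zero, sub_self] at h
    simpa [ip, h1] using h
  induction j generalizing i with
  | zero =>
    cases i with
    | zero => simpa using h0
    | succ i => rw [if_neg (by omega), ← ip_conj, hz, map_zero]
  | succ j ih =>
    cases i with
    | zero => rw [if_neg (by omega), hz]
    | succ i =>
      have h := ip_displacedFock_succ β (displacedFock β (i + 1)) j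
      have h1 : (Real.sqrt (j + 1) : ℂ) ≠ 0 := by exact_mod_cast (sqrt_succ_pos j).ne'
      rw [ann_displacedFock_succ, add_sub_cancel_right] at h
      have h2 : ip ((Real.sqrt (i + 1) : ℂ) • displacedFock β i) (displacedFock β j) =
          (Real.sqrt (i + 1) : ℂ) * ip (displacedFock β i) (displacedFock β j) := by
        simp [ip]
      rw [h2, ih] at h
      apply mul_left_cancel₀ h1
      rw [h]
      by_cases hij : i = j
      · simp [hij]
      · simp [hij]

lemma orthonormal_displacedFock (β : ℂ) :
    Orthonormal ℂ fun n => weighted 0 (displacedFock β n) := by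
  rw [orthonormal_iff_ite]
  exact ip_displacedFock β

/-! ### The displacement operator -/

/-- The displacement operator as an isometry of `ℓ²`. -/
def dispIsometry (β : ℂ) : lp (fun _ : ℕ => ℂ) 2 →ₗᵢ[ℂ] lp (fun _ : ℕ => ℂ) 2 :=
  (orthonormal_displacedFock β).orthogonalFamily.linearIsometry

lemma dispIsometry_hasSum (β : ℂ) (f : lp (fun _ : ℕ => ℂ) 2) (m : ℕ) :
    HasSum (fun n => displacement β m n * f n) (dispIsometry β f m) := by
  have h := (orthonormal_displacedFock β).orthogonalFamily.hasSum_linearIsometry f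
  have h2 := h.mapL (innerSL ℂ (lp.single 2 m (1 : ℂ) : lp (fun _ : ℕ => ℂ) 2))
  simp only [innerSL_apply_apply, lp.inner_single_left, RCLike.inner_apply, map_one, mul_one] at h2
  refine h2.congr_fun fun n => ?_
  simp only [LinearIsometry.toSpanSingleton_apply, lp.coeFn_smul, Pi.smul_apply, smul_eq_mul,
    weighted_zero_apply, displacedFock_apply]
  ring

lemma applyOp_displacement (β : ℂ) (ψ : rapidDecay) (m : ℕ) :
    applyOp (displacement β) ψ m = dispIsometry β (weighted 0 ψ) m := by
  rw [← (dispIsometry_hasSum β (weighted 0 ψ) m).tsum_eq]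
  simp only [weighted_zero_apply]
  rfl

lemma applyOp_displacement_hasSum (β : ℂ) (ψ : rapidDecay) (m : ℕ) :
    HasSum (fun n => displacement β m n * ψ.1 n) (applyOp (displacement β) ψ m) := by
  rw [applyOp_displacement]
  simpa only [weighted_zero_apply] using dispIsometry_hasSum β (weighted 0 ψ) m

lemma applyOp_displacement_norm_hasSum (β : ℂ) (ψ : rapidDecay) :
    HasSum (fun n => ‖applyOp (displacement β) ψ n‖ ^ 2) (nrm 0 ψ ^ 2) := by
  simp only [applyOp_displacement]
  rw [nrm, ← (dispIsometry β).norm_map]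
  exact lp_hasSum_norm_sq _

/-- The relation `a D(β) = D(β) (a + β)` on vectors; it carries one power of the weight through the
displacement. -/
lemma sqrt_succ_mul_applyOp_displacement (β : ℂ) (ψ : rapidDecay) (m : ℕ) :
    (Real.sqrt (m + 1) : ℂ) * applyOp (displacement β) ψ (m + 1) =
      applyOp (displacement β) ((ann ψ + β • ψ : rapidDecay) : ℕ → ℂ) m := by
  have h1 := (applyOp_displacement_hasSum β ψ (m + 1)).mul_left (Real.sqrt (m + 1) : ℂ)
  have h2 := (applyOp_displacement_hasSum β ψ m).mul_left β
  have h3 := h1.sub h2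
  have h4 := (hasSum_nat_add_iff' 1).2 h3
  -- The `n = 0` term of the difference vanishes, so the series can be reindexed from `n + 1`.
  rw [range_one, sum_singleton, ← mul_assoc, displacement_succ_zero, mul_assoc, sub_self,
    sub_zero] at h4
  have h5 := h4.add h2
  rw [sub_add_cancel] at h5
  refine h5.unique ?_
  refine (applyOp_displacement_hasSum β (ann ψ + β • ψ) m).congr_fun fun n => ?_
  have h6 := displacement_lower β m n
  have h7 : (ann ψ + β • ψ).1 n = (Real.sqrt (n + 1) : ℂ) * ψ.1 (n + 1) + β * ψ.1 n := rfl
  rw [h7]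
  linear_combination ψ.1 (n + 1) * h6

/-- Induction on the weight from the isometry at `k = 0`: a factor `n + 1` at photon number `n + 1`
turns `D(β)ψ` into `D(β)(a + β)ψ`, and the vacuum component is bounded by the plain norm. The sum
`S` is explicit because convergence is part of the claim. -/
lemma exists_applyOp_displacement_le (β : ℂ) (k : ℕ) :
    ∃ K : ℝ, 0 ≤ K ∧ ∀ ψ : rapidDecay, ∃ S : ℝ, S ≤ (K * nrm k ψ) ^ 2 ∧
      HasSum (fun n : ℕ => ((n : ℝ) + 1) ^ k * ‖applyOp (displacement β) ψ n‖ ^ 2) S := by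
  induction k with
  | zero =>
    refine ⟨1, zero_le_one, fun ψ => ⟨nrm 0 ψ ^ 2, by rw [one_mul], ?_⟩⟩
    simpa using applyOp_displacement_norm_hasSum β ψ
  | succ k ih =>
    obtain ⟨K, hK, h⟩ := ih
    refine ⟨1 + 2 ^ (k + 1) * (K * (1 + ‖β‖)), by positivity, fun ψ => ?_⟩
    obtain ⟨S, hS, hsum⟩ := h (ann ψ + β • ψ)
    have hle : ∀ n : ℕ, (((n + 1 : ℕ) : ℝ) + 1) ^ (k + 1) *
        ‖applyOp (displacement β) ψ (n + 1)‖ ^ 2 ≤ 2 ^ (k + 1) * (((n : ℝ) + 1) ^ k *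
        ‖applyOp (displacement β) ((ann ψ + β • ψ : rapidDecay) : ℕ → ℂ) n‖ ^ 2) := by
      intro n
      rw [← sqrt_succ_mul_applyOp_displacement, norm_sqrt_succ_mul_sq]
      have h1 : (((n + 1 : ℕ) : ℝ) + 1) ^ (k + 1) ≤ (2 * ((n : ℝ) + 1)) ^ (k + 1) := by
        gcongr
        push_cast
        linarith [n.cast_nonneg (α := ℝ)]
      calc _ ≤ (2 * ((n : ℝ) + 1)) ^ (k + 1) * ‖applyOp (displacement β) ψ (n + 1)‖ ^ 2 := by
            gcongr
        _ = _ := by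
            rw [mul_pow]
            ring
    have hs1 : Summable fun n : ℕ => (((n + 1 : ℕ) : ℝ) + 1) ^ (k + 1) *
        ‖applyOp (displacement β) ψ (n + 1)‖ ^ 2 :=
      Summable.of_nonneg_of_le (fun n => by positivity) hle (hsum.mul_left _).summable
    have hs2 := (summable_nat_add_iff (f := fun n : ℕ => ((n : ℝ) + 1) ^ (k + 1) *
        ‖applyOp (displacement β) ψ n‖ ^ 2) 1).1 hs1
    refine ⟨_, ?_, hs2.hasSum⟩
    rw [hs2.tsum_eq_zero_add]
    have h2 := hasSum_le hle hs1.hasSum (hsum.mul_left (2 ^ (k + 1)))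
    have h3 : ‖applyOp (displacement β) ψ 0‖ ^ 2 ≤ nrm (k + 1) ψ ^ 2 :=
      (le_hasSum (applyOp_displacement_norm_hasSum β ψ) 0 fun n _ => by positivity).trans
        (pow_le_pow_left₀ (nrm_nonneg _ _) (nrm_mono (Nat.zero_le _) ψ) 2)
    have h4 : nrm k (ann ψ + β • ψ) ≤ (1 + ‖β‖) * nrm (k + 1) ψ := by
      refine (nrm_add_le _ _ _).trans ?_
      rw [nrm_smul]
      have := nrm_mono (Nat.le_succ k) ψ
      have := nrm_ann_le k ψ
      nlinarith [norm_nonneg β]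
    have h5 : S ≤ (K * ((1 + ‖β‖) * nrm (k + 1) ψ)) ^ 2 := by
      refine hS.trans (pow_le_pow_left₀ (mul_nonneg hK (nrm_nonneg _ _)) ?_ 2)
      gcongr
    have h6 : (1 : ℝ) ≤ 2 ^ (k + 1) := one_le_pow₀ (by norm_num)
    have h7 := nrm_nonneg (k + 1) ψ
    set N := nrm (k + 1) ψ
    set B := K * (1 + ‖β‖) with hB
    have hB0 : 0 ≤ B := by positivity
    have h8 : (2 : ℝ) ^ (k + 1) * S ≤ (2 ^ (k + 1) * (B * N)) ^ 2 := by
      have h9 : S ≤ (B * N) ^ 2 := by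
        rw [hB]
        refine h5.trans_eq ?_
        ring
      calc (2 : ℝ) ^ (k + 1) * S ≤ 2 ^ (k + 1) * (B * N) ^ 2 := by gcongr
        _ ≤ (2 ^ (k + 1)) ^ 2 * (B * N) ^ 2 := by
            gcongr
            nlinarith
        _ = _ := by ring
    have h10 : 0 ≤ 2 ^ (k + 1) * (B * N) * N := by positivity
    simp only [Nat.cast_zero, zero_add, one_pow, one_mul]
    nlinarith

/-- The displacement operator on rapidly decreasing sequences. -/
def disp (β : ℂ) : rapidDecay →ₗ[ℂ] rapidDecay where
  toFun ψ := ⟨applyOp (displacement β) ψ, fun k => by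
    obtain ⟨K, -, h⟩ := exists_applyOp_displacement_le β k
    obtain ⟨S, -, h⟩ := h ψ
    exact h.summable⟩
  map_add' ψ φ := by
    ext m
    refine (applyOp_displacement_hasSum β (ψ + φ) m).unique ?_
    refine ((applyOp_displacement_hasSum β ψ m).add
      (applyOp_displacement_hasSum β φ m)).congr_fun fun n => ?_
    exact mul_add _ _ _
  map_smul' c ψ := by
    ext m
    refine (applyOp_displacement_hasSum β (c • ψ) m).unique ?_
    refine ((applyOp_displacement_hasSum β ψ m).mul_left c).congr_fun fun n => ?_
    exact mul_left_comm _ _ _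

lemma nrm_zero_disp (β : ℂ) (ψ : rapidDecay) : nrm 0 (disp β ψ) = nrm 0 ψ := by
  have h := (nrm_zero_hasSum (disp β ψ)).unique (applyOp_displacement_norm_hasSum β ψ)
  exact (pow_left_inj₀ (nrm_nonneg _ _) (nrm_nonneg _ _) two_ne_zero).1 h

lemma exists_nrm_disp_le (β : ℂ) (k : ℕ) :
    ∃ K : ℝ, 0 ≤ K ∧ ∀ ψ : rapidDecay, nrm k (disp β ψ) ≤ K * nrm k ψ := by
  obtain ⟨K, hK, h⟩ := exists_applyOp_displacement_le β k
  refine ⟨K, hK, fun ψ => ?_⟩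
  obtain ⟨S, hS, hs⟩ := h ψ
  refine le_of_pow_le_pow_left₀ two_ne_zero (mul_nonneg hK (nrm_nonneg _ _)) ?_
  rw [(nrm_hasSum k (disp β ψ)).unique hs]
  exact hS

lemma weighted_zero_disp (β : ℂ) (ψ : rapidDecay) :
    weighted 0 (disp β ψ) = dispIsometry β (weighted 0 ψ) := by
  ext m
  rw [weighted_zero_apply, ← applyOp_displacement]
  rfl

/-- The vacuum as a rapidly decreasing sequence. -/
def vac : rapidDecay := ⟨vacuum, fun k => summable_of_ne_finset_zero (s := {0}) fun n hn => by
  simp at hn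
  simp [vacuum, hn]⟩

lemma applyOp_single (M : Matrix ℕ ℕ ℂ) (n m : ℕ) :
    applyOp M (Pi.single n 1) m = M m n := by
  rw [applyOp, tsum_eq_single n]
  · simp
  · intro k hk
    simp [hk]

lemma disp_vac (β : ℂ) : disp β vac = displacedFock β 0 := by
  ext m
  exact applyOp_single _ 0 m

/-- As `D(-β) = D(β)†`, the components of the left side are inner products with displaced Fock
states, which the isometry `D(β)` reduces to components of `ψ`. -/
lemma disp_neg_disp (β : ℂ) (ψ : rapidDecay) : disp (-β) (disp β ψ) = ψ := by
  ext m
  have h1 := applyOp_displacement_hasSum (-β) (disp β ψ) m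
  have h2 : ip (displacedFock β m) (disp β ψ) = ψ.1 m := by
    unfold ip
    have h3 : weighted 0 (displacedFock β m) = dispIsometry β (lp.single 2 m (1 : ℂ)) := by
      ext l
      rw [weighted_zero_apply]
      refine HasSum.unique ?_ (dispIsometry_hasSum β _ l)
      have := hasSum_single (f := fun n => displacement β l n *
        (lp.single 2 m (1 : ℂ) : lp (fun _ : ℕ => ℂ) 2) n) m (fun n hn => by
          simp [lp.single_apply, hn])
      simpa [lp.single_apply, displacedFock_apply] using this
    rw [weighted_zero_disp, h3, LinearIsometry.inner_map_map, lp.inner_single_left,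
      weighted_zero_apply]
    simp
  rw [← h2]
  refine h1.unique ((ip_hasSum _ _).congr_fun fun n => ?_)
  rw [displacedFock_apply, star_displacement, mul_comm]

/-- The overlap of two coherent states is an exponential, here a positive multiple of `exp (-b̄ γ)`.
-/
lemma disp_displacedFock_zero_ne_zero (b γ : ℂ) : (disp b (displacedFock γ 0)).1 0 ≠ 0 := by
  have h1 := applyOp_displacement_hasSum b (displacedFock γ 0) 0
  have h2 : HasSum (fun n : ℕ => (-(starRingEnd ℂ) b * γ) ^ n / (n.factorial : ℂ))
      (Complex.exp (-(starRingEnd ℂ) b * γ)) := by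
    rw [Complex.exp_eq_exp_ℂ]
    exact NormedSpace.expSeries_div_hasSum_exp _
  have h3 := h2.mul_left ((Real.exp (-‖b‖ ^ 2 / 2) : ℂ) * (Real.exp (-‖γ‖ ^ 2 / 2) : ℂ))
  have h4 : (disp b (displacedFock γ 0)).1 0 = _ := h1.unique (h3.congr_fun fun n => by
    have hs : (n.factorial : ℂ) = (Real.sqrt n.factorial : ℂ) * (Real.sqrt n.factorial : ℂ) := by
      rw [← Complex.ofReal_mul, Real.mul_self_sqrt (by positivity)]
      simp
    have hs0 : (Real.sqrt n.factorial : ℂ) ≠ 0 := by exact_mod_cast (sqrt_factorial_pos n).ne'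
    rw [displacedFock_apply, ← neg_neg b, ← star_displacement, displacement_zero_right,
      displacement_zero_right, hs]
    simp only [map_mul, map_div₀, map_pow, Complex.conj_ofReal, norm_neg, neg_neg, map_neg,
      mul_pow]
    field_simp)
  rw [h4]
  simp

lemma cre_ne_zero {h : rapidDecay} (hh : h ≠ 0) : cre h ≠ 0 := by
  intro h0
  have h1 := nrm_le_nrm_cre h
  rw [h0, nrm_zero] at h1
  exact hh (nrm_eq_zero (le_antisymm h1 (nrm_nonneg _ _)))

/-- A displaced photon-added vector is never proportional to a coherent state. -/
lemma exists_disp_disp_cre_ne_zero (γ b : ℂ) {h : rapidDecay} (hh : h ≠ 0) :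
    ∃ m, 1 ≤ m ∧ (disp γ (disp b (cre h))).1 m ≠ 0 := by
  by_contra! hcon
  set φ := disp γ (disp b (cre h)) with hφ
  have h1 : φ = φ.1 0 • vac := by
    ext m
    change φ.1 m = φ.1 0 * vacuum m
    cases m with
    | zero => simp [vacuum]
    | succ m => simp [vacuum, hcon (m + 1) (by omega)]
  have h2 : cre h = φ.1 0 • disp (-b) (displacedFock (-γ) 0) := by
    rw [← disp_vac, ← map_smul, ← map_smul, ← h1, hφ, disp_neg_disp, disp_neg_disp]
  -- Vacuum amplitudes are compared: a photon-added vector has none, a displaced coherent state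
  -- always has one.
  have h3 : (0 : ℂ) = φ.1 0 * (disp (-b) (displacedFock (-γ) 0)).1 0 :=
    congrArg (fun ψ : rapidDecay => ψ.1 0) h2
  have h4 : φ.1 0 = 0 :=
    (mul_eq_zero.1 h3.symm).resolve_right (disp_displacedFock_zero_ne_zero _ _)
  rw [h4, zero_smul] at h2
  exact cre_ne_zero hh h2

/-! ### The Gaussian state -/

lemma raiseExp_two_add (c : ℂ) (n k : ℕ) :
    raiseExp 2 c (n + 2 * k) n = c ^ k / (k.factorial : ℂ) *
      (Real.sqrt (((n + 2 * k).factorial : ℝ) / (n.factorial : ℝ)) : ℂ) := by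
  rw [raiseExp, sum_eq_single k]
  · rw [if_pos rfl]
  · intro j _ hj
    rw [if_neg (by omega)]
  · intro hk
    simp at hk
    omega

lemma raiseExp_two_eq_zero {c : ℂ} {m n : ℕ} (h : ∀ k, n + 2 * k ≠ m) : raiseExp 2 c m n = 0 :=
  sum_eq_zero fun k _ => if_neg (h k)

/-- The central binomial bound; its `4^k` cancels the `1/2` in the exponent `-τ (a†)² / 2`, so that
`|τ| < 1` suffices for decay. -/
lemma factorial_two_mul_le (k : ℕ) : (2 * k).factorial ≤ 4 ^ k * (k.factorial * k.factorial) := by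
  have h := Nat.add_choose_mul_factorial_mul_factorial k k
  have h2 := Nat.choose_le_two_pow (k + k) k
  rw [show 2 * k = k + k by ring, ← h,
    show (4 : ℕ) ^ k = 2 ^ (k + k) by rw [pow_add, ← mul_pow]; norm_num, mul_assoc]
  gcongr

/-- The bound is factored for Cauchy–Schwarz over `l`: one factor sums to `(μ + t)^m`, the other is
dominated by the series of `exp (B/μ)`. -/
lemma norm_raiseExp_two_mul_sq_le {c x : ℂ} {t μ B : ℝ} (hc : ‖c‖ = t / 2) (hμ : 0 < μ)
    (hB : 0 ≤ B) {m l : ℕ} (hl : l ≤ m) (hx : ‖x‖ ^ 2 ≤ B ^ l / (l.factorial : ℝ)) :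
    (‖raiseExp 2 c m l * x‖) ^ 2 ≤
      (μ ^ l * t ^ (m - l) * (m.choose l : ℝ)) * ((B / μ) ^ l / (l.factorial : ℝ)) := by
  have ht : 0 ≤ t := by linarith [norm_nonneg c]
  by_cases h : ∃ k, l + 2 * k = m
  · obtain ⟨k, rfl⟩ := h
    have hk : (0 : ℝ) < k.factorial := by exact_mod_cast k.factorial_pos
    have hl0 : (0 : ℝ) < l.factorial := by exact_mod_cast l.factorial_pos
    have h1 : ((l + 2 * k).factorial : ℝ) =
        ((l + 2 * k).choose l : ℝ) * l.factorial * (2 * k).factorial := by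
      have := Nat.add_choose_mul_factorial_mul_factorial l (2 * k)
      rw [← Nat.choose_symm_add] at this
      exact_mod_cast this.symm
    have h2 : ((2 * k).factorial : ℝ) ≤ 4 ^ k * (k.factorial * k.factorial) := by
      exact_mod_cast factorial_two_mul_le k
    rw [raiseExp_two_add, norm_mul, norm_mul, norm_div, norm_pow, mul_pow, mul_pow,
      Complex.norm_real, Real.norm_eq_abs, sq_abs, Real.sq_sqrt (by positivity), hc,
      Complex.norm_natCast, h1, Nat.add_sub_cancel_left]
    have h3 : ((t / 2) ^ k / (k.factorial : ℝ)) ^ 2 *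
        (((l + 2 * k).choose l : ℝ) * l.factorial * (2 * k).factorial / l.factorial) ≤
        t ^ (2 * k) * ((l + 2 * k).choose l : ℝ) := by
      have e : ((t / 2) ^ k / (k.factorial : ℝ)) ^ 2 *
          (((l + 2 * k).choose l : ℝ) * l.factorial * (2 * k).factorial / l.factorial) =
          t ^ (2 * k) * ((l + 2 * k).choose l : ℝ) *
          ((2 * k).factorial / (4 ^ k * (k.factorial * k.factorial))) := by
        rw [show (4 : ℝ) ^ k = (2 ^ k) ^ 2 by rw [← pow_mul, mul_comm, pow_mul]; norm_num,
          pow_mul', div_pow t]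
        field_simp
      rw [e]
      refine mul_le_of_le_one_right (by positivity) ?_
      rw [div_le_one (by positivity)]
      exact h2
    calc _ ≤ (t ^ (2 * k) * ((l + 2 * k).choose l : ℝ)) * (B ^ l / (l.factorial : ℝ)) := by
          gcongr
      _ = _ := by
          rw [div_pow]
          field_simp
  · push Not at h
    rw [raiseExp_two_eq_zero h, zero_mul, norm_zero, zero_pow two_ne_zero]
    positivity

lemma norm_sum_raiseExp_two_sq_le {c : ℂ} {x : ℕ → ℂ} {t μ B : ℝ} (hc : ‖c‖ = t / 2) (hμ : 0 < μ)
    (hB : 0 ≤ B) (hx : ∀ l, ‖x l‖ ^ 2 ≤ B ^ l / (l.factorial : ℝ)) (m : ℕ) :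
    ‖∑ l ∈ range (m + 1), raiseExp 2 c m l * x l‖ ^ 2 ≤ (μ + t) ^ m * Real.exp (B / μ) := by
  have ht : 0 ≤ t := by linarith [norm_nonneg c]
  calc _ ≤ (∑ l ∈ range (m + 1), ‖raiseExp 2 c m l * x l‖) ^ 2 := by
        gcongr
        exact norm_sum_le _ _
    _ ≤ (∑ l ∈ range (m + 1), μ ^ l * t ^ (m - l) * (m.choose l : ℝ)) *
        ∑ l ∈ range (m + 1), (B / μ) ^ l / (l.factorial : ℝ) := by
        refine sum_sq_le_sum_mul_sum_of_sq_le_mul _ (fun l _ => by positivity)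
          (fun l _ => by positivity) fun l hl => ?_
        exact norm_raiseExp_two_mul_sq_le hc hμ hB (by simp at hl; omega) (hx l)
    _ ≤ _ := by
        rw [← add_pow]
        gcongr
        exact Real.sum_le_exp_of_nonneg (by positivity) _

lemma summable_weight_mul_geometric (k : ℕ) {q : ℝ} (hq0 : 0 < q) (hq : q < 1) :
    Summable fun n : ℕ => ((n : ℝ) + 1) ^ k * q ^ n := by
  have h := (summable_nat_add_iff 1).2 (summable_pow_mul_geometric_of_norm_lt_one (R := ℝ) k
    (r := q) (by rwa [Real.norm_eq_abs, abs_of_pos hq0]))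
  refine (h.mul_left q⁻¹).congr fun n => ?_
  rw [pow_succ]
  push_cast
  field_simp

lemma coherent_eq (α : ℂ) (n : ℕ) :
    coherent α n = (Real.exp (-‖α‖ ^ 2 / 2) : ℂ) * (α ^ n / (Real.sqrt n.factorial : ℂ)) := by
  rw [← displacement_zero_right]
  exact applyOp_single _ 0 n

/-- Coherent states are eigenvectors of `exp (c a²)`. -/
lemma hasSum_lowerExp_coherent (c α : ℂ) (l : ℕ) :
    HasSum (fun n => lowerExp 2 c l n * coherent α n)
      (Complex.exp (c * α ^ 2) * coherent α l) := by
  have hinj : Function.Injective fun k : ℕ => l + 2 * k := fun i j h => by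
    simp only at h
    omega
  rw [← hinj.hasSum_iff]
  · have h : HasSum (fun k : ℕ => (c * α ^ 2) ^ k / (k.factorial : ℂ))
        (Complex.exp (c * α ^ 2)) := by
      rw [Complex.exp_eq_exp_ℂ]
      exact NormedSpace.expSeries_div_hasSum_exp _
    refine (h.mul_right (coherent α l)).congr_fun fun k => ?_
    have h1 : (Real.sqrt (l + 2 * k).factorial : ℂ) ≠ 0 := by
      exact_mod_cast (sqrt_factorial_pos (l + 2 * k)).ne'
    have h2 : (Real.sqrt l.factorial : ℂ) ≠ 0 := by exact_mod_cast (sqrt_factorial_pos l).ne'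
    simp only [Function.comp, lowerExp, Matrix.transpose_apply, raiseExp_two_add, coherent_eq]
    rw [Real.sqrt_div (by positivity), mul_pow, ← pow_mul, pow_add]
    push_cast
    field_simp
  · intro n hn
    rw [lowerExp, Matrix.transpose_apply, raiseExp_two_eq_zero, zero_mul]
    intro k hk
    exact hn ⟨k, hk⟩

lemma lowerExp_two_eq_zero_of_lt {c : ℂ} {l n : ℕ} (h : n < l) : lowerExp 2 c l n = 0 :=
  raiseExp_two_eq_zero fun k => by omega

/-- Cutting the intermediate sum at the row index instead of the column index makes its range
independent of `n`, so it can be exchanged with the sum over `n`. -/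
lemma squeezing_apply (z : ℂ) (m n : ℕ) :
    squeezing z m n = (((Real.sqrt (Real.cosh ‖z‖))⁻¹ : ℝ) : ℂ) *
      ∑ l ∈ range (m + 1), raiseExp 2 (-squeezeTanh z / 2) m l *
      (((Real.cosh ‖z‖ ^ l)⁻¹ : ℝ) : ℂ) * lowerExp 2 ((starRingEnd ℂ) (squeezeTanh z) / 2) l n := by
  rw [squeezing]
  congr 1
  have h1 : ∀ N, n ≤ N → ∑ l ∈ range (n + 1), raiseExp 2 (-squeezeTanh z / 2) m l *
      (((Real.cosh ‖z‖ ^ l)⁻¹ : ℝ) : ℂ) * lowerExp 2 ((starRingEnd ℂ) (squeezeTanh z) / 2) l n =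
      ∑ l ∈ range (N + 1), raiseExp 2 (-squeezeTanh z / 2) m l *
      (((Real.cosh ‖z‖ ^ l)⁻¹ : ℝ) : ℂ) *
        lowerExp 2 ((starRingEnd ℂ) (squeezeTanh z) / 2) l n := by
    intro N hN
    refine sum_subset (range_mono (by omega)) fun l _ hl => ?_
    rw [lowerExp_two_eq_zero_of_lt (by simp at hl; omega), mul_zero]
  rw [h1 (max m n) (le_max_right m n)]
  symm
  refine sum_subset (range_mono (by omega)) fun l _ hl => ?_
  rw [raiseExp_two_eq_zero (fun k => by simp at hl; omega), zero_mul, zero_mul]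

lemma applyOp_squeezing_coherent (z α : ℂ) (m : ℕ) :
    applyOp (squeezing z) (coherent α) m =
      (((Real.sqrt (Real.cosh ‖z‖))⁻¹ : ℝ) : ℂ) *
        Complex.exp ((starRingEnd ℂ) (squeezeTanh z) / 2 * α ^ 2) *
      ∑ l ∈ range (m + 1), raiseExp 2 (-squeezeTanh z / 2) m l *
        ((((Real.cosh ‖z‖ ^ l)⁻¹ : ℝ) : ℂ) * coherent α l) := by
  rw [applyOp]
  have h : HasSum (fun n => squeezing z m n * coherent α n)
      ((((Real.sqrt (Real.cosh ‖z‖))⁻¹ : ℝ) : ℂ) * ∑ l ∈ range (m + 1),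
        raiseExp 2 (-squeezeTanh z / 2) m l * (((Real.cosh ‖z‖ ^ l)⁻¹ : ℝ) : ℂ) *
        (Complex.exp ((starRingEnd ℂ) (squeezeTanh z) / 2 * α ^ 2) * coherent α l)) := by
    refine ((hasSum_sum fun l _ => (hasSum_lowerExp_coherent
      ((starRingEnd ℂ) (squeezeTanh z) / 2) α l).mul_left _).mul_left _).congr_fun fun n => ?_
    rw [squeezing_apply, mul_assoc, sum_mul]
    congr 1
    exact sum_congr rfl fun l _ => mul_assoc _ _ _
  rw [h.tsum_eq, mul_assoc, mul_sum, mul_sum, mul_sum]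
  refine sum_congr rfl fun l _ => ?_
  ring

lemma norm_squeezeTanh (z : ℂ) : ‖squeezeTanh z‖ = |Real.tanh ‖z‖| := by
  rw [squeezeTanh, norm_mul, Complex.norm_exp_ofReal_mul_I, one_mul, Complex.norm_real,
    Real.norm_eq_abs]

lemma norm_coherent_sq_le (α : ℂ) (l : ℕ) :
    ‖coherent α l‖ ^ 2 ≤ (‖α‖ ^ 2) ^ l / (l.factorial : ℝ) := by
  rw [coherent_eq, ← displacement_zero_right, norm_displacement_zero_right_sq]
  refine mul_le_of_le_one_left (by positivity) (Real.exp_le_one_iff.2 ?_)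
  nlinarith [sq_nonneg ‖α‖]

lemma gaussian_mem (d : Detector) : d.gaussian ∈ rapidDecay := by
  intro k
  set t := ‖squeezeTanh d.z‖ with ht
  have ht1 : t < 1 := by
    rw [ht, norm_squeezeTanh]
    exact Real.abs_tanh_lt_one _
  have ht0 : 0 ≤ t := norm_nonneg _
  -- Any `μ > 0` with `μ + t < 1` gives geometric decay of the amplitudes.
  set μ := (1 - t) / 2 with hμ
  have hμ0 : 0 < μ := by rw [hμ]; linarith
  have hs := summable_weight_mul_geometric k (q := μ + t) (by linarith) (by rw [hμ]; linarith)
  set C := (((Real.sqrt (Real.cosh ‖d.z‖))⁻¹ : ℝ) : ℂ) *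
        Complex.exp ((starRingEnd ℂ) (squeezeTanh d.z) / 2 * d.α ^ 2) with hC
  refine Summable.of_nonneg_of_le (fun n => by positivity) (fun n => ?_)
    (hs.mul_left (‖C‖ ^ 2 * Real.exp (‖d.α‖ ^ 2 / μ)))
  rw [Detector.gaussian, applyOp_squeezing_coherent, ← hC, norm_mul, mul_pow]
  have h := norm_sum_raiseExp_two_sq_le (c := -squeezeTanh d.z / 2) (t := t) (μ := μ)
    (B := ‖d.α‖ ^ 2) (x := fun l => (((Real.cosh ‖d.z‖ ^ l)⁻¹ : ℝ) : ℂ) * coherent d.α l)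
    (by rw [norm_div, norm_neg, Complex.norm_ofNat]) hμ0 (by positivity)
    (fun l => (norm_attenuation_sq_le ‖d.z‖ (coherent d.α) l).trans (norm_coherent_sq_le _ _)) n
  calc _ ≤ ((n : ℝ) + 1) ^ k * (‖C‖ ^ 2 * ((μ + t) ^ n * Real.exp (‖d.α‖ ^ 2 / μ))) := by
        gcongr
    _ = _ := by ring

lemma gaussian_zero_ne_zero (d : Detector) : d.gaussian 0 ≠ 0 := by
  rw [Detector.gaussian, applyOp_squeezing_coherent]
  have h1 : Real.sqrt (Real.cosh ‖d.z‖) ≠ 0 := (Real.sqrt_pos.2 (Real.cosh_pos _)).ne'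
  have h2 := raiseExp_two_add (-squeezeTanh d.z / 2) 0 0
  simp only [mul_zero, add_zero] at h2
  simp [h2, coherent_eq, h1]

/-- The Gaussian state `S(z) |α⟩` as a rapidly decreasing sequence. -/
def gaussianVec (d : Detector) : rapidDecay := ⟨d.gaussian, gaussian_mem d⟩

lemma gaussianVec_ne_zero (d : Detector) : gaussianVec d ≠ 0 := fun h =>
  gaussian_zero_ne_zero d (congrArg (fun ψ : rapidDecay => ψ.1 0) h)

/-! ### Chains of photon additions -/

/-- The displaced attenuated photon addition `D(β) a† (cosh ξ)^(-a†a) D(β)†`. -/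
def photonAddition (β : ℂ) (ξ : ℝ) : rapidDecay →ₗ[ℂ] rapidDecay :=
  disp β ∘ₗ cre ∘ₗ att ξ ∘ₗ disp (-β)

lemma photonAddition_apply (β : ℂ) (ξ : ℝ) (ψ : rapidDecay) :
    photonAddition β ξ ψ = disp β (cre (att ξ (disp (-β) ψ))) := rfl

/-- The product of the attenuated photon additions, applied to `g`. -/
def chain {n : ℕ} (β : Fin n → ℂ) (ξ : Fin n → ℝ) (g : rapidDecay) : rapidDecay :=
  Fin.foldl n (fun ψ j => photonAddition (β j) (ξ j) ψ) g

lemma chain_zero (β : Fin 0 → ℂ) (ξ : Fin 0 → ℝ) (g : rapidDecay) : chain β ξ g = g :=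
  Fin.foldl_zero _ _

lemma chain_succ {n : ℕ} (β : Fin (n + 1) → ℂ) (ξ : Fin (n + 1) → ℝ) (g : rapidDecay) :
    chain β ξ g = photonAddition (β (Fin.last n)) (ξ (Fin.last n))
      (chain (fun j => β j.castSucc) (fun j => ξ j.castSucc) g) :=
  Fin.foldl_succ_last _ _

lemma coe_foldl {n : ℕ} (f : rapidDecay → Fin n → rapidDecay)
    (f' : (ℕ → ℂ) → Fin n → (ℕ → ℂ)) (h : ∀ ψ j, (f ψ j : ℕ → ℂ) = f' ψ j) (x : rapidDecay) :
    ((Fin.foldl n f x : rapidDecay) : ℕ → ℂ) = Fin.foldl n f' x := by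
  induction n with
  | zero => simp
  | succ n ih =>
    rw [Fin.foldl_succ_last, Fin.foldl_succ_last, h,
      ih _ (fun ψ j => f' ψ j.castSucc) fun ψ j => h ψ j.castSucc]

lemma build_attenuated (d : Detector) (ξ : Fin d.rank → ℝ) :
    d.build (fun j ψ => creation (attenuation (ξ j) ψ)) = chain d.β ξ (gaussianVec d) := by
  symm
  refine coe_foldl _ _ (fun ψ j => ?_) _
  rw [conjTranspose_displacement]
  rfl

lemma build_creation (d : Detector) :
    d.build (fun _ => creation) = chain d.β 0 (gaussianVec d) := by
  rw [← build_attenuated]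
  congr 1
  ext j ψ n
  have h : attenuation 0 ψ = ψ := by
    ext n
    simp [attenuation]
  rw [Pi.zero_apply, h]

lemma photonAddition_zero (β : ℂ) (ψ : rapidDecay) :
    photonAddition β 0 ψ = disp β (cre (disp (-β) ψ)) := by
  rw [photonAddition_apply, att_zero]

lemma nrm_le_nrm_photonAddition (β : ℂ) (ψ : rapidDecay) :
    nrm 0 ψ ≤ nrm 0 (photonAddition β 0 ψ) := by
  rw [photonAddition_zero, nrm_zero_disp]
  exact (nrm_zero_disp (-β) ψ).symm.le.trans (nrm_le_nrm_cre _)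

lemma nrm_le_nrm_chain {n : ℕ} (β : Fin n → ℂ) (g : rapidDecay) :
    nrm 0 g ≤ nrm 0 (chain β 0 g) := by
  induction n with
  | zero => rw [chain_zero]
  | succ n ih =>
    rw [chain_succ]
    exact (ih _).trans (nrm_le_nrm_photonAddition _ _)

lemma nrm_pos {ψ : rapidDecay} (h : ψ ≠ 0) : 0 < nrm 0 ψ :=
  (nrm_nonneg 0 ψ).lt_of_ne fun h0 => h (nrm_eq_zero h0.symm)

lemma chain_ne_zero {n : ℕ} (β : Fin n → ℂ) {g : rapidDecay} (hg : g ≠ 0) :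
    chain β 0 g ≠ 0 := by
  intro h
  have h1 := nrm_le_nrm_chain β g
  rw [h, nrm_zero] at h1
  exact (nrm_pos hg).not_ge h1

/-- The inherited error `ψ - φ` costs one weight index, for `a†`; the new error costs two more, for
comparing the attenuation with the identity. -/
lemma exists_nrm_photonAddition_sub_le (β : ℂ) (k : ℕ) :
    ∃ K : ℝ, 0 ≤ K ∧ ∀ (ξ : ℝ) (ψ φ : rapidDecay),
      nrm k (photonAddition β ξ ψ - photonAddition β 0 φ) ≤
        K * (nrm (k + 1) (ψ - φ) + ξ ^ 2 * nrm (k + 3) φ) := by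
  obtain ⟨K₁, hK₁, h₁⟩ := exists_nrm_disp_le β k
  obtain ⟨K₂, hK₂, h₂⟩ := exists_nrm_disp_le (-β) (k + 1)
  obtain ⟨K₃, hK₃, h₃⟩ := exists_nrm_disp_le (-β) (k + 3)
  refine ⟨K₁ * (2 ^ k * (K₂ + K₃)), by positivity, fun ξ ψ φ => ?_⟩
  have e : photonAddition β ξ ψ - photonAddition β 0 φ =
      disp β (cre (att ξ (disp (-β) (ψ - φ)) + (att ξ (disp (-β) φ) - disp (-β) φ))) := by
    simp only [photonAddition_apply, att_zero, map_sub, map_add]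
    abel
  rw [e]
  have a1 := nrm_att_le (k + 1) ξ (disp (-β) (ψ - φ))
  have a2 := nrm_att_sub_le (k + 1) ξ (disp (-β) φ)
  have a3 := h₂ (ψ - φ)
  have a4 := h₃ φ
  have n1 := nrm_nonneg (k + 1) (ψ - φ)
  have n2 := nrm_nonneg (k + 3) φ
  calc _ ≤ K₁ * (2 ^ k * (nrm (k + 1) (att ξ (disp (-β) (ψ - φ)) +
        (att ξ (disp (-β) φ) - disp (-β) φ)))) := by
        refine (h₁ _).trans ?_
        gcongr
        exact nrm_cre_le _ _
    _ ≤ K₁ * (2 ^ k * (K₂ * nrm (k + 1) (ψ - φ) + ξ ^ 2 * (K₃ * nrm (k + 3) φ))) := by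
        gcongr
        refine (nrm_add_le _ _ _).trans (add_le_add (a1.trans a3) (a2.trans ?_))
        gcongr
    _ ≤ K₁ * (2 ^ k * ((K₂ + K₃) * (nrm (k + 1) (ψ - φ) + ξ ^ 2 * nrm (k + 3) φ))) := by
        gcongr
        have : 0 ≤ ξ ^ 2 * nrm (k + 3) φ := by positivity
        nlinarith [mul_nonneg hK₃ n1, mul_nonneg hK₂ this]
    _ = _ := by ring

/-! ### Balancing the attenuation rates -/

lemma half_sq_le_one_sub_inv_cosh_sq {u : ℝ} (hu : 0 < u) (h : Real.cosh u ^ 2 < 2) :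
    u ^ 2 / 2 ≤ 1 - (Real.cosh u ^ 2)⁻¹ := by
  have h1 : u ≤ Real.sinh u := Real.self_le_sinh_iff.2 hu.le
  have h2 := Real.cosh_sq u
  have h3 : 0 < Real.cosh u ^ 2 := pow_pos (Real.cosh_pos u) 2
  have h4 : 1 - (Real.cosh u ^ 2)⁻¹ = Real.sinh u ^ 2 / Real.cosh u ^ 2 := by
    rw [eq_div_iff h3.ne', sub_mul, inv_mul_cancel₀ h3.ne', h2]
    ring
  rw [h4, div_le_div_iff₀ two_pos h3]
  have h5 : u ^ 2 ≤ Real.sinh u ^ 2 := pow_le_pow_left₀ hu.le h1 2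
  nlinarith [sq_nonneg u]

/-- A photon addition with attenuation `u` absorbs perturbations of size `δ² u²` of its input. -/
lemma exists_nrm_cre_att_le {φ : rapidDecay} {m : ℕ} (hm : 1 ≤ m) (hφ : φ.1 m ≠ 0)
    {L : ℝ} (hL : 0 ≤ L) :
    ∃ δ : ℝ, 0 < δ ∧ ∀ u : ℝ, 0 < u → ∀ χ : rapidDecay, nrm 0 χ ≤ nrm 0 φ →
      nrm 1 (χ - φ) ≤ L * (δ * u) ^ 2 → nrm 0 (cre (att u χ)) ≤ nrm 0 (cre φ) := by
  set κ := ‖φ.1 m‖ ^ 2 / 2 with hκ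
  have hκ0 : 0 < κ := by
    have : 0 < ‖φ.1 m‖ := norm_pos_iff.2 hφ
    positivity
  set M := nrm 0 (cre φ) with hM
  have hM0 : 0 ≤ M := nrm_nonneg _ _
  -- Chosen so that the perturbation `L δ² u²` is at most the loss `M - A`, which is at least `κ u²
  -- / (2M)` when `M > 0`; the `+ 1` keeps the denominator positive.
  refine ⟨Real.sqrt (κ / (L * (2 * M) + 1)), Real.sqrt_pos.2 (by positivity),
    fun u hu χ h1 h2 => ?_⟩
  rcases le_or_gt 2 (Real.cosh u ^ 2) with h | h
  · exact ((nrm_cre_att_le_of_two_le h χ).trans h1).trans (nrm_le_nrm_cre φ)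
  rw [mul_pow, Real.sq_sqrt (by positivity)] at h2
  set A := nrm 0 (cre (att u φ)) with hA
  have hA0 : 0 ≤ A := nrm_nonneg _ _
  have hAM : A ≤ M := nrm_cre_att_le u φ
  have h3 : nrm 0 (cre (att u χ)) ≤ A + nrm 1 (χ - φ) := by
    have e : cre (att u χ) = cre (att u φ) + cre (att u (χ - φ)) := by
      simp only [map_sub]
      abel
    rw [e]
    refine (nrm_add_le _ _ _).trans (add_le_add le_rfl ?_)
    refine (nrm_cre_le 0 _).trans ?_
    rw [pow_zero, one_mul]
    exact nrm_att_le 1 u _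
  -- The loss is first bounded below for squares, then `M² - A² = (M - A)(M + A)` with `A ≤ M`.
  have h4 : κ * u ^ 2 ≤ (M - A) * (2 * M) := by
    have h5 := nrm_cre_att_sq_le u φ hm
    have h6 := half_sq_le_one_sub_inv_cosh_sq hu h
    have h7 : u ^ 2 / 2 * ‖φ.1 m‖ ^ 2 ≤ (1 - (Real.cosh u ^ 2)⁻¹) * ‖φ.1 m‖ ^ 2 := by gcongr
    rw [hκ]
    nlinarith
  have h8 : L * (κ / (L * (2 * M) + 1) * u ^ 2) ≤ M - A := by
    have h9 : L * (κ / (L * (2 * M) + 1) * u ^ 2) = (κ * u ^ 2) * L / (L * (2 * M) + 1) := by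
      ring
    rw [h9, div_le_iff₀ (by positivity)]
    nlinarith
  linarith

/-- Induction on the number of additions. The quadratic error bound is needed in every weighted
norm, because each further addition consumes weight indices; its case `k = 1` determines how much
the earlier rates must shrink. -/
lemma exists_rates {g : rapidDecay} (hg : g ≠ 0) (n : ℕ) (β : Fin n → ℂ) :
    ∃ c : Fin n → ℝ, (∀ j, 0 < c j) ∧
      (∀ u : ℝ, 0 < u → nrm 0 (chain β (fun j => c j * u) g) ≤ nrm 0 (chain β 0 g)) ∧
      ∀ k, ∃ L : ℝ, 0 ≤ L ∧ ∀ u : ℝ, 0 < u →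
        nrm k (chain β (fun j => c j * u) g - chain β 0 g) ≤ L * u ^ 2 := by
  induction n with
  | zero =>
    refine ⟨fun _ => 1, fun _ => one_pos, fun u _ => ?_, fun k => ⟨0, le_rfl, fun u _ => ?_⟩⟩
    · rw [chain_zero, chain_zero]
    · simp [chain_zero]
  | succ n ih =>
    set b := β (Fin.last n)
    obtain ⟨c, hc, hle, hdiff⟩ := ih fun j => β j.castSucc
    set F : ℝ → rapidDecay := fun u => chain (fun j => β j.castSucc) (fun j => c j * u) g with hF
    set F₀ : rapidDecay := chain (fun j => β j.castSucc) 0 g with hF₀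
    obtain ⟨δ, hδ, hstep⟩ : ∃ δ : ℝ, 0 < δ ∧ ∀ u : ℝ, 0 < u →
        nrm 0 (cre (att u (disp (-b) (F (δ * u))))) ≤ nrm 0 (cre (disp (-b) F₀)) := by
      cases n with
      | zero =>
        -- A first addition acts on the unperturbed Gaussian vector, which may be the displaced
        -- vacuum; with no error to absorb, no loss is needed.
        refine ⟨1, one_pos, fun u _ => ?_⟩
        simp only [hF, hF₀, chain_zero]
        exact nrm_cre_att_le _ _
      | succ n =>
        obtain ⟨m, hm, hne⟩ : ∃ m, 1 ≤ m ∧ (disp (-b) F₀).1 m ≠ 0 := by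
          rw [hF₀, chain_succ, Pi.zero_apply, photonAddition_zero]
          refine exists_disp_disp_cre_ne_zero _ _ fun h0 => ?_
          have h1 := nrm_zero_disp (-β (Fin.last n).castSucc)
            (chain (fun j => β j.castSucc.castSucc) 0 g)
          have h2 := nrm_pos (chain_ne_zero (fun j => β j.castSucc.castSucc) hg)
          rw [← h1] at h2
          refine h2.ne' ?_
          refine (congrArg (nrm 0) h0).trans (nrm_zero 0)
        obtain ⟨L, hL, hLd⟩ := hdiff 1
        obtain ⟨K, hK, hKd⟩ := exists_nrm_disp_le (-b) 1
        obtain ⟨δ, hδ, h⟩ := exists_nrm_cre_att_le hm hne (mul_nonneg hK hL)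
        refine ⟨δ, hδ, fun u hu => h u hu _ ?_ ?_⟩
        · rw [nrm_zero_disp, nrm_zero_disp]
          exact hle _ (mul_pos hδ hu)
        · rw [← map_sub, mul_assoc]
          refine (hKd _).trans ?_
          gcongr
          exact hLd _ (mul_pos hδ hu)
    -- The last addition gets rate 1 and all earlier ones are slowed by `δ`.
    set c' : Fin (n + 1) → ℝ := Fin.snoc (fun j => δ * c j) 1 with hc'
    have e : ∀ u, chain β (fun j => c' j * u) g = photonAddition b u (F (δ * u)) := by
      intro u
      rw [chain_succ]
      simp only [hc', Fin.snoc_last, Fin.snoc_castSucc, one_mul, hF]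
      congr 2
      ext j
      ring
    have e₀ : chain β 0 g = photonAddition b 0 F₀ := chain_succ _ _ _
    refine ⟨c', fun j => ?_, fun u hu => ?_, fun k => ?_⟩
    · refine Fin.lastCases ?_ (fun j => ?_) j
      · simp [hc']
      · simpa [hc'] using mul_pos hδ (hc j)
    · rw [e, e₀, photonAddition_apply, photonAddition_zero, nrm_zero_disp, nrm_zero_disp]
      exact hstep u hu
    · obtain ⟨K, hK, h⟩ := exists_nrm_photonAddition_sub_le b k
      obtain ⟨L, hL, hLd⟩ := hdiff (k + 1)
      refine ⟨K * (L * δ ^ 2 + nrm (k + 3) F₀), mul_nonneg hK (add_nonneg (by positivity)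
        (nrm_nonneg _ _)), fun u hu => ?_⟩
      rw [e, e₀]
      refine (h u _ _).trans ?_
      rw [mul_assoc]
      refine mul_le_mul_of_nonneg_left ?_ hK
      have := hLd (δ * u) (mul_pos hδ hu)
      rw [mul_pow] at this
      change nrm (k + 1) (F (δ * u) - F₀) ≤ _ at this
      nlinarith

/-- Attenuation parameters along which the attenuated vector does not grow and converges at least
linearly. -/
lemma exists_linear_rates (d : Detector) :
    ∃ c : Fin d.rank → ℝ, (∀ j, 0 < c j) ∧ ∀ u : ℝ, 0 < u →
      nrm 0 (chain d.β (fun j => c j * u) (gaussianVec d)) ≤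
        nrm 0 (chain d.β 0 (gaussianVec d)) ∧
      nrm 0 (chain d.β (fun j => c j * u) (gaussianVec d) - chain d.β 0 (gaussianVec d)) ≤
        u / 2 * nrm 0 (chain d.β 0 (gaussianVec d)) := by
  obtain ⟨c, hc, hle, hdiff⟩ := exists_rates (gaussianVec_ne_zero d) d.rank d.β
  obtain ⟨L, hL, hLd⟩ := hdiff 0
  set ψ₀ := chain d.β 0 (gaussianVec d)
  have hN : 0 < nrm 0 ψ₀ := nrm_pos (chain_ne_zero d.β (gaussianVec_ne_zero d))
  set N := nrm 0 ψ₀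
  -- Rescaling `u` by `r` makes `2N · L (r u)²` at most `(u N / 2)²`.
  set r := Real.sqrt (N / (8 * L + 1)) with hr
  have hr0 : 0 < r := Real.sqrt_pos.2 (by positivity)
  have hr2 : r ^ 2 = N / (8 * L + 1) := Real.sq_sqrt (by positivity)
  refine ⟨fun j => c j * r, fun j => mul_pos (hc j) hr0, fun u hu => ?_⟩
  have e : (fun j => c j * r * u) = fun j => c j * (r * u) := by
    ext j
    ring
  rw [e]
  have h1 := hle (r * u) (mul_pos hr0 hu)
  have h2 := hLd (r * u) (mul_pos hr0 hu)
  have h3 := nrm_sub_le 0 (chain d.β (fun j => c j * (r * u)) (gaussianVec d)) ψ₀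
  refine ⟨h1, ?_⟩
  set E := nrm 0 (chain d.β (fun j => c j * (r * u)) (gaussianVec d) - ψ₀)
  have hE : 0 ≤ E := nrm_nonneg _ _
  -- `E²` is bounded by the product of the uniform bound `2N` and the quadratic one, so `E` is
  -- linear in `u` for small and large `u` alike.
  refine le_of_pow_le_pow_left₀ two_ne_zero (by positivity) ?_
  have h4 : E ≤ 2 * N := by linarith
  have h5 : E ^ 2 ≤ 2 * N * (L * (r * u) ^ 2) := by
    rw [sq]
    exact mul_le_mul h4 h2 hE (by positivity)
  refine h5.trans ?_
  rw [mul_pow, hr2]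
  have h6 : 8 * (L * (N / (8 * L + 1))) ≤ N := by
    rw [show 8 * (L * (N / (8 * L + 1))) = N * (8 * L) / (8 * L + 1) by ring,
      div_le_iff₀ (by positivity)]
    nlinarith
  have h7 : 0 ≤ N * u ^ 2 := by positivity
  nlinarith [mul_le_mul_of_nonneg_right h6 h7]

/-! ### Detector states -/

lemma normFactor_eq (d : Detector) : d.normFactor = nrm 0 (chain d.β 0 (gaussianVec d)) ^ 2 := by
  rw [Detector.normFactor, build_creation]
  exact (nrm_zero_hasSum _).tsum_eq

/-- The detector state as a rapidly decreasing sequence. -/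
def stateVec (d : Detector) : rapidDecay :=
  (((nrm 0 (chain d.β 0 (gaussianVec d)))⁻¹ : ℝ) : ℂ) • chain d.β 0 (gaussianVec d)

/-- The attenuated detector vector as a rapidly decreasing sequence. -/
def attenuatedVec (d : Detector) (ξ : Fin d.rank → ℝ) : rapidDecay :=
  (((nrm 0 (chain d.β 0 (gaussianVec d)))⁻¹ : ℝ) : ℂ) • chain d.β ξ (gaussianVec d)

lemma state_eq (d : Detector) : d.state = stateVec d := by
  ext n
  rw [Detector.state, normFactor_eq, Real.sqrt_sq (nrm_nonneg _ _), build_creation]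
  rfl

lemma attenuatedState_eq (d : Detector) (ξ : Fin d.rank → ℝ) :
    d.attenuatedState ξ = attenuatedVec d ξ := by
  ext n
  rw [Detector.attenuatedState, normFactor_eq, Real.sqrt_sq (nrm_nonneg _ _), build_attenuated]
  rfl

lemma chain_norm_pos (d : Detector) : 0 < nrm 0 (chain d.β 0 (gaussianVec d)) :=
  nrm_pos (chain_ne_zero d.β (gaussianVec_ne_zero d))

lemma nrm_normalised (d : Detector) (ψ : rapidDecay) :
    nrm 0 ((((nrm 0 (chain d.β 0 (gaussianVec d)))⁻¹ : ℝ) : ℂ) • ψ) =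
      nrm 0 ψ / nrm 0 (chain d.β 0 (gaussianVec d)) := by
  rw [nrm_smul, Complex.norm_real, Real.norm_eq_abs,
    abs_of_pos (inv_pos.2 (chain_norm_pos d)), inv_mul_eq_div]

lemma nrm_stateVec (d : Detector) : nrm 0 (stateVec d) = 1 := by
  rw [stateVec, nrm_normalised, div_self (chain_norm_pos d).ne']

lemma exists_attenuation_rates (d : Detector) :
    ∃ c : Fin d.rank → ℝ, (∀ j, 0 < c j) ∧ ∀ u : ℝ, 0 < u →
      nrm 0 (attenuatedVec d fun j => c j * u) ≤ 1 ∧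
      nrm 0 ((attenuatedVec d fun j => c j * u) - stateVec d) ≤ u / 2 := by
  obtain ⟨c, hc, h⟩ := exists_linear_rates d
  refine ⟨c, hc, fun u hu => ?_⟩
  obtain ⟨h1, h2⟩ := h u hu
  have e : (attenuatedVec d fun j => c j * u) - stateVec d =
      (((nrm 0 (chain d.β 0 (gaussianVec d)))⁻¹ : ℝ) : ℂ) •
        (chain d.β (fun j => c j * u) (gaussianVec d) - chain d.β 0 (gaussianVec d)) :=
    (smul_sub _ _ _).symm
  rw [e, attenuatedVec, nrm_normalised, nrm_normalised,
    div_le_one (chain_norm_pos d), div_le_iff₀ (chain_norm_pos d)]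
  exact ⟨h1, h2⟩

/-! ### Product vectors -/

lemma hasSum_prod_of_nonneg {m : ℕ} {f : Fin m → ℕ → ℝ} {s : Fin m → ℝ}
    (h0 : ∀ k n, 0 ≤ f k n) (h : ∀ k, HasSum (f k) (s k)) :
    HasSum (fun n : Fin m → ℕ => ∏ k, f k (n k)) (∏ k, s k) := by
  induction m with
  | zero => simp
  | succ m ih =>
    have h1 := ih (fun k n => h0 k.succ n) fun k => h k.succ
    have hs : Summable fun x : ℕ × (Fin m → ℕ) => f 0 x.1 * ∏ k, f (Fin.succ k) (x.2 k) :=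
      Summable.mul_of_nonneg (f := f 0) (g := fun n : Fin m → ℕ => ∏ k, f (Fin.succ k) (n k))
        (h 0).summable h1.summable (h0 0) fun n => prod_nonneg fun k _ => h0 k.succ (n k)
    have h2 := (h 0).mul h1 hs
    rw [Fin.prod_univ_succ, ← (Fin.consEquiv fun _ => ℕ).hasSum_iff]
    refine h2.congr_fun fun n => ?_
    simp [Fin.prod_univ_succ, Fin.consEquiv]

/-- The tensor product of square-summable vectors, as a multilinear map. -/
def tensor (m : ℕ) :
    MultilinearMap ℂ (fun _ : Fin m => lp (fun _ : ℕ => ℂ) 2) (Modes m) where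
  toFun v := ⟨fun n => ∏ k, v k (n k), memlp_two_iff.2 (by
    simp only [norm_prod, ← prod_pow]
    exact (hasSum_prod_of_nonneg (fun k n => by positivity)
      fun k => lp_hasSum_norm_sq (v k)).summable)⟩
  map_update_add' v i x y := by
    ext n
    exact ((MultilinearMap.mkPiAlgebra ℂ (Fin m) ℂ).compLinearMap fun k =>
      (lp.evalCLM ℂ (fun _ : ℕ => ℂ) 2 (n k)).toLinearMap).map_update_add v i x y
  map_update_smul' v i c x := by
    ext n
    exact ((MultilinearMap.mkPiAlgebra ℂ (Fin m) ℂ).compLinearMap fun k =>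
      (lp.evalCLM ℂ (fun _ : ℕ => ℂ) 2 (n k)).toLinearMap).map_update_smul v i c x

lemma norm_tensor {m : ℕ} (v : Fin m → lp (fun _ : ℕ => ℂ) 2) :
    ‖tensor m v‖ = ∏ k, ‖v k‖ := by
  have h := hasSum_prod_of_nonneg (fun k n => by positivity) fun k => lp_hasSum_norm_sq (v k)
  have h1 := lp_hasSum_norm_sq (tensor m v)
  have h2 : ∀ n, ‖tensor m v n‖ ^ 2 = ∏ k, ‖v k (n k)‖ ^ 2 := fun n => by
    change ‖∏ k, v k (n k)‖ ^ 2 = _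
    rw [norm_prod, prod_pow]
  simp only [h2] at h1
  have h3 := h1.unique h
  rw [prod_pow] at h3
  exact (pow_left_inj₀ (norm_nonneg _) (prod_nonneg fun k _ => norm_nonneg _) two_ne_zero).1 h3

/-- The factors are exchanged one at a time. Since all others have norm at most 1, there is no
growth exponential in `m`; this is why the attenuated vectors must not exceed norm 1. -/
lemma norm_tensor_sub_le {m : ℕ} (v w : Fin m → lp (fun _ : ℕ => ℂ) 2)
    (hv : ∀ k, ‖v k‖ ≤ 1) (hw : ∀ k, ‖w k‖ ≤ 1) :
    ‖tensor m v - tensor m w‖ ≤ ∑ k, ‖v k - w k‖ := by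
  have h := (tensor m).norm_image_sub_le_of_bound' zero_le_one
    (fun v => by rw [norm_tensor, one_mul]) v w
  rw [one_mul] at h
  refine h.trans (sum_le_sum fun i _ => ?_)
  calc _ ≤ ∏ j, if j = i then ‖v i - w i‖ else 1 := by
        refine prod_le_prod (fun j _ => ?_) fun j _ => ?_
        · split_ifs <;> positivity
        · split_ifs
          · exact le_rfl
          · exact max_le (hv j) (hw j)
    _ = _ := by simp

lemma productVector_eq_tensor {m : ℕ} (v : Fin m → rapidDecay) :
    productVector (fun k => (v k).1) = tensor m fun k => weighted 0 (v k) := by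
  have e : (fun n : Fin m → ℕ => ∏ k, (v k).1 (n k)) =
      (tensor m fun k => weighted 0 (v k) : Modes m) := by
    ext n
    exact prod_congr rfl fun k _ => (weighted_zero_apply (v k) (n k)).symm
  rw [productVector, dif_pos (by rw [e]; exact lp.memℓp _)]
  exact Subtype.ext e

/-! ### Born weights -/

lemma inner_fock {m : ℕ} (n : Fin m → ℕ) (x : Modes m) : inner ℂ (fock n) x = x n := by
  rw [fock, lp.inner_single_left]
  simp

lemma bornWeight_eq {m : ℕ} (ρ : DensityOperator m) (ψ : Fin m → ℕ → ℂ) :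
    bornWeight ρ ψ = inner ℂ (productVector ψ) (ρ.op (productVector ψ)) := by
  rw [bornWeight, trace, ← (lp.hasSum_inner (𝕜 := ℂ) _ _).tsum_eq]
  refine tsum_congr fun n => ?_
  rw [ContinuousLinearMap.comp_apply, InnerProductSpace.rankOne_apply, map_smul, inner_smul_right,
    inner_fock, ← inner_conj_symm, inner_fock, RCLike.inner_apply, mul_comm]

lemma _root_.ContinuousLinearMap.IsPositive.exists_eq_star_mul_self {H : Type*}
    [NormedAddCommGroup H] [InnerProductSpace ℂ H] [CompleteSpace H] {A : H →L[ℂ] H}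
    (h : A.IsPositive) : ∃ B : H →L[ℂ] H, A = star B * B :=
  CStarAlgebra.nonneg_iff_eq_star_mul_self.1 ((ContinuousLinearMap.nonneg_iff_isPositive _).2 h)

/-- A density operator is of the form `B† B` with `B` a contraction. -/
lemma exists_contraction {m : ℕ} (ρ : DensityOperator m) :
    ∃ B : Modes m →L[ℂ] Modes m, (∀ x, inner ℂ x (ρ.op x) = (‖B x‖ : ℂ) ^ 2) ∧
      ∀ x, ‖B x‖ ≤ ‖x‖ := by
  obtain ⟨B, hB⟩ := ρ.isPositive.exists_eq_star_mul_self
  have hin : ∀ x, inner ℂ x (ρ.op x) = (‖B x‖ : ℂ) ^ 2 := fun x => by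
    rw [hB, mul_apply_eq_comp, ContinuousLinearMap.star_eq_adjoint,
      ContinuousLinearMap.adjoint_inner_right, inner_self_eq_norm_sq_to_K]
    rfl
  refine ⟨B, hin, fun x => ?_⟩
  -- Unit trace says that `B` has Hilbert–Schmidt norm 1; Cauchy–Schwarz on the partial sums of `B x
  -- = ∑ x n • B |n⟩` then makes it a contraction.
  have htr : HasSum (fun n : Fin m → ℕ => ‖B (fock n)‖ ^ 2) 1 := by
    have h := ρ.trace_eq_one
    simp only [hin] at h
    rw [← Complex.hasSum_ofReal]
    simpa using h
  have hx := lp_hasSum_norm_sq x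
  have hBx : HasSum (fun n => x n • B (fock n)) (B x) := by
    refine ((lp.hasSum_single (by norm_num) x).mapL B).congr_fun fun n => ?_
    rw [← map_smul, fock, ← lp.single_smul, smul_eq_mul, mul_one]
  refine le_of_tendsto hBx.norm (Filter.Eventually.of_forall fun s => ?_)
  refine (norm_sum_le _ _).trans (le_of_pow_le_pow_left₀ two_ne_zero (norm_nonneg _) ?_)
  simp only [norm_smul]
  refine (sum_mul_sq_le_sq_mul_sq _ _ _).trans ?_
  have h1 := sum_le_hasSum s (fun n _ => by positivity) hx
  have h2 := sum_le_hasSum s (fun n _ => by positivity) htr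
  have h3 : 0 ≤ ∑ n ∈ s, ‖x n‖ ^ 2 := sum_nonneg fun n _ => by positivity
  nlinarith

/-- Both expectations are squares `‖B x‖²` and `‖B y‖²`, and their difference factors. -/
lemma norm_inner_sub_inner_le {m : ℕ} (ρ : DensityOperator m) {x y : Modes m}
    (hx : ‖x‖ ≤ 1) (hy : ‖y‖ ≤ 1) :
    ‖(inner ℂ x (ρ.op x) - inner ℂ y (ρ.op y) : ℂ)‖ ≤ 2 * ‖x - y‖ := by
  obtain ⟨B, hin, hB⟩ := exists_contraction ρ
  rw [hin, hin, ← Complex.ofReal_pow, ← Complex.ofReal_pow, ← Complex.ofReal_sub,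
    Complex.norm_real, Real.norm_eq_abs, sq_sub_sq, abs_mul]
  have h1 : |‖B x‖ - ‖B y‖| ≤ ‖x - y‖ := by
    refine (abs_norm_sub_norm_le _ _).trans ?_
    rw [← map_sub]
    exact hB _
  have h2 : |‖B x‖ + ‖B y‖| ≤ 2 := by
    rw [abs_of_nonneg (by positivity)]
    linarith [hB x, hB y]
  gcongr

lemma norm_outcomeProb_sub_approxProb_le {m : ℕ} (d : Fin m → Detector)
    (ξ : ∀ k, Fin (d k).rank → ℝ) (h : ∀ k, nrm 0 (attenuatedVec (d k) (ξ k)) ≤ 1)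
    (ρ : DensityOperator m) :
    ‖outcomeProb d ρ - approxProb d ξ ρ‖ ≤
      2 * ∑ k, nrm 0 (attenuatedVec (d k) (ξ k) - stateVec (d k)) := by
  have h1 : ∀ k, ‖weighted 0 (stateVec (d k))‖ ≤ 1 := fun k => (nrm_stateVec (d k)).le
  have norm_le : ∀ v : Fin m → lp (fun _ : ℕ => ℂ) 2, (∀ k, ‖v k‖ ≤ 1) → ‖tensor m v‖ ≤ 1 :=
    fun v hv => by
      rw [norm_tensor]
      exact prod_le_one (fun k _ => norm_nonneg _) fun k _ => hv k
  rw [outcomeProb, approxProb, bornWeight_eq, bornWeight_eq]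
  simp only [state_eq, attenuatedState_eq]
  rw [productVector_eq_tensor, productVector_eq_tensor]
  refine (norm_inner_sub_inner_le ρ (norm_le _ h1) (norm_le _ h)).trans ?_
  refine mul_le_mul_of_nonneg_left ?_ two_pos.le
  rw [norm_sub_rev]
  refine (norm_tensor_sub_le _ _ h h1).trans_eq ?_
  exact sum_congr rfl fun k _ => by rw [nrm, map_sub]

end BosonicSampling

end

theorem theorem1 :
    ∃ p : ∀ d : BosonicSampling.Detector, Fin d.rank → MvPolynomial (Fin 2) ℝ,
      ∀ (m : ℕ) (d : Fin m → BosonicSampling.Detector) (ε : ℝ), 0 < ε →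
      ∀ ξ : ∀ k, Fin (d k).rank → ℝ,
        (∀ k j, ξ k j = MvPolynomial.eval ![ε, 1 / (m : ℝ)] (p (d k) j)) →
        (∀ k j, 0 < ξ k j) ∧
        (∀ k, HasSum (fun n => ‖(d k).state n‖ ^ 2) 1) ∧
        (∀ k, Summable (fun n => ‖(d k).attenuatedState (ξ k) n‖ ^ 2)) ∧
        ∀ ρ : BosonicSampling.DensityOperator m,
          ‖BosonicSampling.outcomeProb d ρ - BosonicSampling.approxProb d ξ ρ‖ ≤ ε := by
  choose c hc h using BosonicSampling.exists_attenuation_rates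
  refine ⟨fun d j => MvPolynomial.C (c d j) * (MvPolynomial.X 0 * MvPolynomial.X 1),
    fun m d ε hε ξ hξ => ?_⟩
  -- Positivity of `m` is drawn from an index `k`, so `m = 0` stays admissible.
  have hm : ∀ k : Fin m, (0 : ℝ) < m := fun k => by exact_mod_cast k.pos
  have hξ' : ∀ k, ξ k = fun j => c (d k) j * (ε / m) := fun k => by
    ext j
    rw [hξ]
    simp [div_eq_mul_inv]
  have hu : ∀ k : Fin m, 0 < ε / m := fun k => div_pos hε (hm k)
  have h1 : ∀ k, BosonicSampling.nrm 0 (BosonicSampling.attenuatedVec (d k) (ξ k)) ≤ 1 :=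
    fun k => by
      rw [hξ' k]
      exact (h (d k) _ (hu k)).1
  refine ⟨fun k j => ?_, fun k => ?_, fun k => ?_, fun ρ => ?_⟩
  · rw [hξ' k]
    exact mul_pos (hc _ _) (hu k)
  · have h2 := BosonicSampling.nrm_zero_hasSum (BosonicSampling.stateVec (d k))
    rwa [BosonicSampling.nrm_stateVec, one_pow, ← BosonicSampling.state_eq] at h2
  · have h2 := BosonicSampling.nrm_zero_hasSum (BosonicSampling.attenuatedVec (d k) (ξ k))
    rw [← BosonicSampling.attenuatedState_eq] at h2
    exact h2.summable
  · refine (BosonicSampling.norm_outcomeProb_sub_approxProb_le d ξ h1 ρ).trans ?_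
    have h2 : ∀ k, BosonicSampling.nrm 0 (BosonicSampling.attenuatedVec (d k) (ξ k) -
        BosonicSampling.stateVec (d k)) ≤ ε / m / 2 := fun k => by
      rw [hξ' k]
      exact (h (d k) _ (hu k)).2
    have h3 := Finset.sum_le_sum fun k (_ : k ∈ Finset.univ) => h2 k
    rw [Finset.sum_const, Finset.card_univ, Fintype.card_fin, nsmul_eq_mul] at h3
    -- For `m = 0` the sum of errors is empty; otherwise `m` errors of `ε / (2m)`, doubled, give
    -- exactly `ε`.
    rcases m.eq_zero_or_pos with rfl | hpos
    · simpa using hε.le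
    · have h4 : (m : ℝ) ≠ 0 := by exact_mod_cast hpos.ne'
      have h5 : (m : ℝ) * (ε / m / 2) = ε / 2 := by field_simp
      linarith
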